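/- Let $\mathcal{E}_\lambda$, $\lambda\in[0,1]$, be the pure-loss channel on one bosonic mode with Fock basis $(|n\rangle)_{n\ge 0}$: $\mathcal{E}_\lambda(\rho)=\mathrm{Tr}_E\big[U_\lambda(\rho\otimes|0\rangle\langle 0|_E)U_\lambda^\dagger\big]$ with $U_\lambda=\exp[\arccos(\sqrt\lambda)(a^\dagger b-ab^\dagger)]$. For a probability measure $\mu$ on $[0,1]$ (for example $\mu=\sum_n p_n\delta_{\lambda_n}$) let $\Phi_\mu=\int\mathcal{E}_\lambda\,d\mu(\lambda)$ be the fading channel, and write $\langle f(\lambda)\rangle=\int f\,d\mu$. A channel $\Phi$ is degradable if $\tilde\Phi=\mathcal{D}\circ\Phi$ for a quantum channel $\mathcal{D}$ and a complementary channel $\tilde\Phi$ of $\Phi$, that is, $\tilde\Phi(\rho)=\mathrm{Tr}_S[V\rho V^\dagger]$ for a Stinespring isometry $V$ with $\Phi(\rho)=\mathrm{Tr}_E[V\rho V^\dagger]$. The Choi matrix of a channel $\Phi$ with qubit input is $\sum_{i,j\in\{0,1\}}|i\rangle\langle j|\otimes\Phi(|i\rangle\langle j|)$. Then: 1. Every degradable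 channel from a qubit to a qubit has a Choi matrix of rank at most $2$. 2. For every $\mu$, the channel $\Phi_\mu$ maps operators on $\mathrm{span}\{|0\rangle,|1\rangle\}$ to operators on $\mathrm{span}\{|0\rangle,|1\rangle\}$, and the Choi matrix of this restriction is, in the basis $|00\rangle,|01\rangle,|10\rangle,|11\rangle$, $$\begin{pmatrix}1&0&0&\langle\sqrt\lambda\rangle\\0&0&0&0\\0&0&1-\langle\lambda\rangle&0\\\langle\sqrt\lambda\rangle&0&0&\langle\lambda\rangle\end{pmatrix}.$$ 3. If $\mu$ is not a Dirac measure, then $\langle\lambda\rangle<1$, $\langle\lambda\rangle-\langle\sqrt\lambda\rangle^2>0$, this Choi matrix has rank $3$, and $\Phi_\mu$ is not degradable. 4. Consequently, if $\Phi_\mu$ is degradable, then $\mu=\delta_\lambda$ for some $\lambda\in[0,1]$, and $\Phi_\mu=\mathcal{E}_\lambda$ is a single pure-loss channel. -/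

import Mathlib

open scoped InnerProductSpace ComplexOrder InnerProduct
open MeasureTheory

noncomputable section

/-- The complex Hilbert space `ℓ²(ι)`. -/
abbrev Hil (ι : Type) : Type := lp (fun _ : ι => ℂ) 2

/-- Bounded operators from `ℓ²(ι)` to `ℓ²(κ)`. -/
abbrev BOp (ι κ : Type) : Type := Hil ι →L[ℂ] Hil κ

open Classical in
/-- The standard orthonormal basis vector `|i⟩` of `ℓ²(ι)`. -/
def ket {ι : Type} (i : ι) : Hil ι := lp.single 2 i (1 : ℂ)

theorem ket_eq {ι : Type} [DecidableEq ι] (i : ι) : (ket i : Hil ι) = lp.single 2 i (1 : ℂ) := by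
  unfold ket
  congr
  exact Subsingleton.elim _ _

theorem inner_ket {ι : Type} (i : ι) (x : Hil ι) : ⟪ket i, x⟫_ℂ = x i := by
  classical
  rw [ket_eq, lp.inner_single_left]
  simp

theorem ket_apply {ι : Type} [DecidableEq ι] (i j : ι) :
    (ket i : Hil ι) j = if j = i then 1 else 0 := by
  rw [ket_eq, lp.single_apply]
  by_cases h : j = i
  · subst h; simp
  · simp [h]

theorem orthonormal_ket {ι : Type} : Orthonormal ℂ (ket : ι → Hil ι) := by
  classical
  rw [orthonormal_iff_ite]
  intro i j
  rw [inner_ket, ket_apply]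

/-- The linear isometry of `ℓ²(ι)` that sends `|i⟩` to the `i`-th vector of an orthonormal
family. -/
def isometryOfOrthonormal {ι κ : Type} {v : ι → Hil κ} (hv : Orthonormal ℂ v) :
    Hil ι →ₗᵢ[ℂ] Hil κ :=
  hv.orthogonalFamily.linearIsometry

theorem isometryOfOrthonormal_ket {ι κ : Type} {v : ι → Hil κ} (hv : Orthonormal ℂ v) (i : ι) :
    isometryOfOrthonormal hv (ket i) = v i := by
  classical
  rw [isometryOfOrthonormal, ket_eq, OrthogonalFamily.linearIsometry_apply_single]
  simp

theorem hasSum_ket {ι : Type} (x : Hil ι) : HasSum (fun i => x i • ket i) x := by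
  classical
  have := lp.hasSum_single (E := fun _ : ι => ℂ) (p := 2) (by simp) x
  convert this using 2 with i
  ext j
  rw [ket_eq, lp.coeFn_smul, Pi.smul_apply, lp.single_apply, lp.single_apply]
  by_cases h : j = i
  · subst h; simp
  · simp [h]

theorem hasSum_norm_sq {ι : Type} (x : Hil ι) : HasSum (fun i => ‖x i‖ ^ 2) (‖x‖ ^ 2) := by
  have := lp.hasSum_norm (E := fun _ : ι => ℂ) (p := 2) (by simp) x
  simpa using this

/-! ### Trace-class operators -/

/-- A positive operator of finite trace. -/
def IsPosFiniteTrace {ι : Type} (P : BOp ι ι) : Prop :=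
  P.IsPositive ∧ Summable fun i => (⟪ket i, P (ket i)⟫_ℂ).re

/-- The trace-class operators on `ℓ²(ι)`: the complex linear span of the positive operators of
finite trace. -/
def TraceClass (ι : Type) : Submodule ℂ (BOp ι ι) :=
  Submodule.span ℂ {P | IsPosFiniteTrace P}

theorem traceClass_induction {ι : Type} {p : TraceClass ι → Prop}
    (hpos : ∀ P : TraceClass ι, IsPosFiniteTrace (P : BOp ι ι) → p P) (hzero : p 0)
    (hadd : ∀ S T, p S → p T → p (S + T)) (hsmul : ∀ (c : ℂ) (T), p T → p (c • T))
    (ρ : TraceClass ι) : p ρ := by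
  obtain ⟨T, hT⟩ := ρ
  exact Submodule.span_induction (p := fun T hT => p ⟨T, hT⟩)
    (fun P hP => hpos ⟨P, Submodule.subset_span hP⟩ hP) hzero
    (fun S T hS hT h1 h2 => hadd ⟨S, hS⟩ ⟨T, hT⟩ h1 h2)
    (fun c T hT h => hsmul c ⟨T, hT⟩ h) hT

/-- The trace. -/
def opTrace {ι : Type} (T : TraceClass ι) : ℂ := ∑' i, ⟪ket i, (T : BOp ι ι) (ket i)⟫_ℂ

/-- The linear map between trace-class operators given by a map `f` on bounded operators that is
linear on trace-class operators and maps positive operators of finite trace to such operators. -/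
def traceClassMap {ι κ : Type} (f : BOp ι ι → BOp κ κ)
    (hadd : ∀ S ∈ TraceClass ι, ∀ T ∈ TraceClass ι, f (S + T) = f S + f T)
    (hsmul : ∀ (c : ℂ), ∀ T ∈ TraceClass ι, f (c • T) = c • f T)
    (hpos : ∀ P, IsPosFiniteTrace P → f P ∈ TraceClass κ) :
    TraceClass ι →ₗ[ℂ] TraceClass κ where
  toFun T := ⟨f T, by
    obtain ⟨T, hT⟩ := T
    have h0 : f 0 = 0 := by simpa using hsmul 0 0 (Submodule.zero_mem _)
    refine Submodule.span_induction (p := fun T _ => f T ∈ TraceClass κ) ?_ ?_ ?_ ?_ hT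
    · exact fun P hP => hpos P hP
    · rw [h0]; exact Submodule.zero_mem _
    · intro S T hS hT h1 h2
      rw [hadd S hS T hT]; exact Submodule.add_mem _ h1 h2
    · intro c T hT h
      rw [hsmul c T hT]; exact Submodule.smul_mem _ c h⟩
  map_add' S T := Subtype.ext (hadd S S.2 T T.2)
  map_smul' c T := Subtype.ext (hsmul c T T.2)

theorem exists_sqrt_of_isPositive {E : Type} [NormedAddCommGroup E] [InnerProductSpace ℂ E]
    [CompleteSpace E] {P : E →L[ℂ] E} (hP : P.IsPositive) :
    ∃ S : E →L[ℂ] E, IsSelfAdjoint S ∧ S ∘L S = P := by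
  have h : 0 ≤ P := (ContinuousLinearMap.nonneg_iff_isPositive P).2 hP
  exact ⟨CFC.sqrt P, IsSelfAdjoint.of_nonneg (CFC.sqrt_nonneg P), CFC.sqrt_mul_sqrt_self P h⟩

theorem inner_sq_eq {ι : Type} {P S : BOp ι ι} (hS : IsSelfAdjoint S) (hSP : S ∘L S = P)
    (x : Hil ι) : (⟪x, P x⟫_ℂ).re = ‖S x‖ ^ 2 := by
  rw [← hSP, ContinuousLinearMap.comp_apply, ← ContinuousLinearMap.adjoint_inner_left,
    hS.adjoint_eq]
  exact inner_self_eq_norm_sq (𝕜 := ℂ) (S x)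

/-- `A P A†` has finite trace; the diagonal sums are bounded by `‖A‖² Tr P`. -/
theorem sum_conj_le {ι κ : Type} {P : BOp ι ι} (hP : IsPosFiniteTrace P) (A : BOp ι κ)
    (s : Finset κ) :
    ∑ j ∈ s, (⟪ket j, (A ∘L P ∘L A†) (ket j)⟫_ℂ).re ≤
      ‖A‖ ^ 2 * ∑' i, (⟪ket i, P (ket i)⟫_ℂ).re := by
  obtain ⟨S, hS, hSP⟩ := exists_sqrt_of_isPositive hP.1
  have hsum : Summable fun i => ‖S (ket i)‖ ^ 2 := by
    simpa only [inner_sq_eq hS hSP] using hP.2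
  have key : ∀ j, (⟪ket j, (A ∘L P ∘L A†) (ket j)⟫_ℂ).re = ‖S ((A†) (ket j))‖ ^ 2 := by
    intro j
    rw [← inner_sq_eq hS hSP, ContinuousLinearMap.comp_apply, ContinuousLinearMap.comp_apply,
      ← ContinuousLinearMap.adjoint_inner_left]
  have key2 : ∀ j, HasSum (fun i => ‖⟪ket j, A (S (ket i))⟫_ℂ‖ ^ 2)
      ((⟪ket j, (A ∘L P ∘L A†) (ket j)⟫_ℂ).re) := by
    intro j
    rw [key]
    convert hasSum_norm_sq (S ((A†) (ket j))) using 2 with i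
    rw [← inner_ket, ← ContinuousLinearMap.adjoint_inner_left S, hS.adjoint_eq,
      ContinuousLinearMap.adjoint_inner_right A, norm_inner_symm]
  have h1 := hasSum_sum (s := s) (fun j _ => key2 j)
  have h2 : ∀ i, ∑ j ∈ s, ‖⟪ket j, A (S (ket i))⟫_ℂ‖ ^ 2 ≤ ‖A‖ ^ 2 * ‖S (ket i)‖ ^ 2 := by
    intro i
    refine (orthonormal_ket.sum_inner_products_le (x := A (S (ket i)))).trans ?_
    rw [← mul_pow]
    exact pow_le_pow_left₀ (norm_nonneg _) (A.le_opNorm _) 2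
  have h3 := hasSum_le h2 h1 (hsum.hasSum.mul_left (‖A‖ ^ 2))
  simpa only [inner_sq_eq hS hSP] using h3

theorem IsPosFiniteTrace.re_nonneg {ι : Type} {P : BOp ι ι} (hP : P.IsPositive) (x : Hil ι) :
    0 ≤ (⟪x, P x⟫_ℂ).re :=
  hP.re_inner_nonneg_right x

theorem IsPosFiniteTrace.conj {ι κ : Type} {P : BOp ι ι} (hP : IsPosFiniteTrace P)
    (A : BOp ι κ) : IsPosFiniteTrace (A ∘L P ∘L A†) :=
  ⟨hP.1.conj_adjoint A, summable_of_sum_le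
    (fun j => IsPosFiniteTrace.re_nonneg (hP.1.conj_adjoint A) (ket j)) (sum_conj_le hP A)⟩

/-- The map `T ↦ A T A†` on trace-class operators. -/
def conjMap {ι κ : Type} (A : BOp ι κ) : TraceClass ι →ₗ[ℂ] TraceClass κ :=
  traceClassMap (fun T => A ∘L T ∘L A†)
    (fun S _ T _ => by simp [ContinuousLinearMap.add_comp, ContinuousLinearMap.comp_add])
    (fun c T _ => by simp [ContinuousLinearMap.smul_comp])
    (fun _ hP => Submodule.subset_span (hP.conj A))

theorem IsPosFiniteTrace.norm_le {ι : Type} {P : BOp ι ι} (hP : IsPosFiniteTrace P) :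
    ‖P‖ ≤ ∑' i, (⟪ket i, P (ket i)⟫_ℂ).re := by
  obtain ⟨S, hS, hSP⟩ := exists_sqrt_of_isPositive hP.1
  have h0 : 0 ≤ ∑' i, (⟪ket i, P (ket i)⟫_ℂ).re :=
    tsum_nonneg fun i => IsPosFiniteTrace.re_nonneg hP.1 (ket i)
  have hb : ∀ x, ‖S x‖ ^ 2 ≤ (∑' i, (⟪ket i, P (ket i)⟫_ℂ).re) * ‖x‖ ^ 2 := by
    intro x
    refine hasSum_le ?_ (hasSum_norm_sq (S x)) (hP.2.hasSum.mul_right (‖x‖ ^ 2))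
    intro i
    rw [← inner_ket, inner_sq_eq hS hSP, ← ContinuousLinearMap.adjoint_inner_left, hS.adjoint_eq,
      ← mul_pow]
    exact pow_le_pow_left₀ (norm_nonneg _) (norm_inner_le_norm _ _) 2
  have hSn : ‖S‖ ≤ Real.sqrt (∑' i, (⟪ket i, P (ket i)⟫_ℂ).re) := by
    refine S.opNorm_le_bound (Real.sqrt_nonneg _) fun x => ?_
    refine le_of_sq_le_sq ?_ (by positivity)
    rw [mul_pow, Real.sq_sqrt h0]
    exact hb x
  calc ‖P‖ = ‖S ∘L S‖ := by rw [hSP]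
    _ ≤ ‖S‖ * ‖S‖ := S.opNorm_comp_le S
    _ ≤ _ := by
      rw [← Real.mul_self_sqrt h0]
      exact mul_le_mul hSn hSn (norm_nonneg _) (Real.sqrt_nonneg _)

/-! ### Partial trace -/

/-- For a bipartition `e : ι × κ ≃ γ` of the index set of `ℓ²(γ) = ℓ²(ι) ⊗ ℓ²(κ)`, the isometry
`x ↦ x ⊗ |k⟩`. -/
def tensorKet {ι κ γ : Type} (e : ι × κ ≃ γ) (k : κ) : Hil ι →ₗᵢ[ℂ] Hil γ :=
  isometryOfOrthonormal (v := fun i => ket (e (i, k)))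
    (orthonormal_ket.comp _ fun i j h => by simpa using h)

theorem tensorKet_ket {ι κ γ : Type} (e : ι × κ ≃ γ) (k : κ) (i : ι) :
    tensorKet e k (ket i) = ket (e (i, k)) :=
  isometryOfOrthonormal_ket _ i

/-- The block `(1 ⊗ ⟨k|) T (1 ⊗ |k⟩)` of `T`. -/
def block {ι κ γ : Type} (e : ι × κ ≃ γ) (k : κ) (T : BOp γ γ) : BOp ι ι :=
  (tensorKet e k).toContinuousLinearMap† ∘L T ∘L (tensorKet e k).toContinuousLinearMap

theorem inner_block {ι κ γ : Type} (e : ι × κ ≃ γ) (k : κ) (T : BOp γ γ) (i j : ι) :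
    ⟪ket i, block e k T (ket j)⟫_ℂ = ⟪ket (e (i, k)), T (ket (e (j, k)))⟫_ℂ := by
  simp [block, ContinuousLinearMap.adjoint_inner_right, tensorKet_ket]

theorem isPosFiniteTrace_block {ι κ γ : Type} (e : ι × κ ≃ γ) (k : κ) {P : BOp γ γ}
    (hP : IsPosFiniteTrace P) : IsPosFiniteTrace (block e k P) := by
  have h := hP.conj ((tensorKet e k).toContinuousLinearMap†)
  rwa [ContinuousLinearMap.adjoint_adjoint] at h

theorem summable_diag {ι κ γ : Type} (e : ι × κ ≃ γ) {P : BOp γ γ} (hP : IsPosFiniteTrace P) :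
    Summable fun x : κ × ι => (⟪ket (e (x.2, x.1)), P (ket (e (x.2, x.1)))⟫_ℂ).re :=
  hP.2.comp_injective (i := fun x : κ × ι => e (x.2, x.1))
    (e.injective.comp Prod.swap_injective)

theorem summable_norm_block_of_pos {ι κ γ : Type} (e : ι × κ ≃ γ) {P : BOp γ γ}
    (hP : IsPosFiniteTrace P) : Summable fun k => ‖block e k P‖ := by
  refine Summable.of_nonneg_of_le (fun _ => norm_nonneg _)
    (fun k => (isPosFiniteTrace_block e k hP).norm_le) ?_
  simp only [inner_block]
  exact (summable_diag e hP).prod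

theorem block_add {ι κ γ : Type} (e : ι × κ ≃ γ) (k : κ) (S T : BOp γ γ) :
    block e k (S + T) = block e k S + block e k T := by
  simp [block, ContinuousLinearMap.add_comp, ContinuousLinearMap.comp_add]

theorem block_smul {ι κ γ : Type} (e : ι × κ ≃ γ) (k : κ) (c : ℂ) (T : BOp γ γ) :
    block e k (c • T) = c • block e k T := by
  simp [block, ContinuousLinearMap.smul_comp]

theorem summable_block {ι κ γ : Type} (e : ι × κ ≃ γ) {T : BOp γ γ}
    (hT : T ∈ TraceClass γ) : Summable fun k => block e k T := by
  refine Submodule.span_induction (p := fun T _ => Summable fun k => block e k T) ?_ ?_ ?_ ?_ hT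
  · exact fun P hP => (summable_norm_block_of_pos e hP).of_norm
  · simp [block]
  · intro S T _ _ h1 h2
    simpa only [block_add] using h1.add h2
  · intro c T _ h
    simpa only [block_smul] using h.const_smul c

theorem inner_tsum_block {ι κ γ : Type} (e : ι × κ ≃ γ) {T : BOp γ γ}
    (hT : T ∈ TraceClass γ) (x y : Hil ι) :
    HasSum (fun k => ⟪x, block e k T y⟫_ℂ) ⟪x, (∑' k, block e k T) y⟫_ℂ := by
  have h := (summable_block e hT).hasSum
  have h1 := (ContinuousLinearMap.apply ℂ (Hil ι) y).hasSum h
  exact (innerSL ℂ x).hasSum h1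

theorem isPositive_of_re_nonneg {ι : Type} {T : BOp ι ι} (h : ∀ x, 0 ≤ ⟪x, T x⟫_ℂ) :
    T.IsPositive := by
  rw [ContinuousLinearMap.isPositive_iff_complex]
  intro x
  have hx := h x
  rw [← inner_conj_symm, (RCLike.nonneg_iff.1 hx |>.2 |> RCLike.conj_eq_iff_im.2)]
  rw [Complex.le_def] at hx
  constructor
  · apply Complex.ext
    · simp
    · simpa using hx.2
  · simpa using hx.1

theorem isPosFiniteTrace_tsum_block {ι κ γ : Type} (e : ι × κ ≃ γ) {P : BOp γ γ}
    (hP : IsPosFiniteTrace P) : IsPosFiniteTrace (∑' k, block e k P) := by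
  have hT : P ∈ TraceClass γ := Submodule.subset_span hP
  refine ⟨isPositive_of_re_nonneg fun x => ?_, ?_⟩
  · exact (inner_tsum_block e hT x x).nonneg
      fun k => (isPosFiniteTrace_block e k hP).1.inner_nonneg_right x
  · have h : ∀ i, (⟪ket i, (∑' k, block e k P) (ket i)⟫_ℂ).re =
        ∑' k, (⟪ket (e (i, k)), P (ket (e (i, k)))⟫_ℂ).re := by
      intro i
      have := Complex.hasSum_re (inner_tsum_block e hT (ket i) (ket i))
      simpa only [inner_block] using this.tsum_eq.symm
    simp only [h]
    exact (hP.2.comp_injective e.injective).prod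

/-- The partial trace `Tr_κ T = ∑ₖ (1 ⊗ ⟨k|) T (1 ⊗ |k⟩)` over the second factor of
`ℓ²(γ) = ℓ²(ι) ⊗ ℓ²(κ)`; the series converges in operator norm. -/
def partialTrace {ι κ γ : Type} (e : ι × κ ≃ γ) : TraceClass γ →ₗ[ℂ] TraceClass ι :=
  traceClassMap (fun T => ∑' k, block e k T)
    (fun S hS T hT => by
      simp only [block_add]
      exact (summable_block e hS).tsum_add (summable_block e hT))
    (fun c T hT => by
      simp only [block_smul]
      exact (summable_block e hT).tsum_const_smul c)
    (fun _ hP => Submodule.subset_span (isPosFiniteTrace_tsum_block e hP))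

/-- `Tr_κ` on `ℓ²(ι) ⊗ ℓ²(κ) = ℓ²(ι × κ)`. -/
def traceRight (ι κ : Type) : TraceClass (ι × κ) →ₗ[ℂ] TraceClass ι :=
  partialTrace (Equiv.refl (ι × κ))

/-- `Tr_ι` on `ℓ²(ι) ⊗ ℓ²(κ) = ℓ²(ι × κ)`. -/
def traceLeft (ι κ : Type) : TraceClass (ι × κ) →ₗ[ℂ] TraceClass κ :=
  partialTrace (Equiv.prodComm κ ι)

/-! ### Quantum channels, complementary channels, degradability, Choi matrix -/

/-- Complete positivity: for every `n`, the map `id ⊗ Φ` on `n × n` block matrices of trace-class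
operators preserves positivity of the quadratic form. -/
def IsCompletelyPositive {ι κ : Type} (Φ : TraceClass ι →ₗ[ℂ] TraceClass κ) : Prop :=
  ∀ (n : ℕ) (X : Fin n → Fin n → TraceClass ι),
    (∀ v : Fin n → Hil ι, 0 ≤ ∑ a, ∑ b, ⟪v a, (X a b : BOp ι ι) (v b)⟫_ℂ) →
    ∀ w : Fin n → Hil κ, 0 ≤ ∑ a, ∑ b, ⟪w a, (Φ (X a b) : BOp κ κ) (w b)⟫_ℂ

/-- A quantum channel: a completely positive trace-preserving linear map. -/
def IsQuantumChannel {ι κ : Type} (Φ : TraceClass ι →ₗ[ℂ] TraceClass κ) : Prop :=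
  IsCompletelyPositive Φ ∧ ∀ T, opTrace (Φ T) = opTrace T

/-- `Ψ` is a complementary channel of `Φ`: there is a Stinespring isometry
`V : ℓ²(ι) → ℓ²(κ) ⊗ ℓ²(ε)` with `Φ(ρ) = Tr_E (V ρ V†)` and `Ψ(ρ) = Tr_S (V ρ V†)`. -/
def IsComplementary {ι κ ε : Type} (Φ : TraceClass ι →ₗ[ℂ] TraceClass κ)
    (Ψ : TraceClass ι →ₗ[ℂ] TraceClass ε) : Prop :=
  ∃ V : Hil ι →ₗᵢ[ℂ] Hil (κ × ε),
    Φ = traceRight κ ε ∘ₗ conjMap V.toContinuousLinearMap ∧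
    Ψ = traceLeft κ ε ∘ₗ conjMap V.toContinuousLinearMap

/-- `Φ` is degradable: some complementary channel of `Φ` is `D ∘ Φ` for a quantum channel `D`. -/
def IsDegradable {ι κ : Type} (Φ : TraceClass ι →ₗ[ℂ] TraceClass κ) : Prop :=
  ∃ (ε : Type) (Ψ : TraceClass ι →ₗ[ℂ] TraceClass ε), IsComplementary Φ Ψ ∧
    ∃ D : TraceClass κ →ₗ[ℂ] TraceClass ε, IsQuantumChannel D ∧ Ψ = D ∘ₗ Φ

theorem rankOne_self_mem_traceClass {ι : Type} (x : Hil ι) :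
    InnerProductSpace.rankOne ℂ x x ∈ TraceClass ι := by
  refine Submodule.subset_span ⟨InnerProductSpace.isPositive_rankOne_self x, ?_⟩
  refine (hasSum_norm_sq x).summable.congr fun i => ?_
  rw [InnerProductSpace.rankOne_apply, inner_smul_right, inner_ket, ← inner_conj_symm, inner_ket,
    Complex.conj_mul', ← Complex.ofReal_pow, Complex.ofReal_re]

theorem rankOne_mem_traceClass {ι : Type} (x y : Hil ι) :
    InnerProductSpace.rankOne ℂ x y ∈ TraceClass ι := by
  have h : InnerProductSpace.rankOne ℂ x y = (1 / 4 : ℂ) •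
      ((InnerProductSpace.rankOne ℂ (x + y) (x + y) -
          InnerProductSpace.rankOne ℂ (x - y) (x - y)) +
        Complex.I • (InnerProductSpace.rankOne ℂ (x + Complex.I • y) (x + Complex.I • y) -
          InnerProductSpace.rankOne ℂ (x - Complex.I • y) (x - Complex.I • y))) := by
    ext1 z
    simp only [map_add, map_sub, add_apply, sub_apply, smul_apply, map_smulₛₗ,
      InnerProductSpace.rankOne_apply, Complex.conj_I]
    match_scalars <;> (try simp only [id_eq]) <;> (try ring_nf) <;> (rw [Complex.I_sq]; ring)
  rw [h]
  exact Submodule.smul_mem _ _ (Submodule.add_mem _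
    (Submodule.sub_mem _ (rankOne_self_mem_traceClass _) (rankOne_self_mem_traceClass _))
    (Submodule.smul_mem _ _
      (Submodule.sub_mem _ (rankOne_self_mem_traceClass _) (rankOne_self_mem_traceClass _))))

/-- The operator `|i⟩⟨j|`. -/
def ketBra {ι : Type} (i j : ι) : TraceClass ι :=
  ⟨InnerProductSpace.rankOne ℂ (ket i) (ket j), rankOne_mem_traceClass _ _⟩

/-- The (unnormalized) Choi matrix `∑ᵢⱼ |i⟩⟨j| ⊗ Φ(|i⟩⟨j|)`, with entry
`⟨m| Φ(|i⟩⟨j|) |n⟩` in row `(i, m)` and column `(j, n)`. -/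
def choiMatrix {ι κ : Type} (Φ : TraceClass ι →ₗ[ℂ] TraceClass κ) : Matrix (ι × κ) (ι × κ) ℂ :=
  Matrix.of fun x y => ⟪ket x.2, (Φ (ketBra x.1 y.1) : BOp κ κ) (ket y.2)⟫_ℂ

/-! ### Beam splitter and pure-loss channels

A bosonic mode is `ℓ²(ℕ)` with the Fock basis `|n⟩`; the signal and environment modes together are
`ℓ²(ℕ × ℕ)`. -/

/-- Fock-basis matrix element `⟨m| a |n⟩` of the annihilation operator, `a|n⟩ = √n |n-1⟩`. -/
def annihilation (m n : ℕ) : ℂ := if n = m + 1 then (Real.sqrt n : ℂ) else 0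

/-- Fock-basis matrix element `⟨m| a† |n⟩` of the creation operator. -/
def creation (m n : ℕ) : ℂ := star (annihilation n m)

/-- Matrix elements `⟨x₁ x₂| a†b - a b† |y₁ y₂⟩`. -/
def beamSplitterGenerator : Matrix (ℕ × ℕ) (ℕ × ℕ) ℂ :=
  Matrix.of fun x y => creation x.1 y.1 * annihilation x.2 y.2 -
    annihilation x.1 y.1 * creation x.2 y.2

/-- The Fock states `|n₁, n₂⟩` of total photon number `n₁ + n₂ = N`. -/
abbrev Sector (N : ℕ) : Type := {x : ℕ × ℕ // x ∈ Finset.HasAntidiagonal.antidiagonal N}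

/-- The restriction of `exp(θ (a†b - a b†))` to the span of the states with total photon number
`N`, a finite-dimensional space that the generator leaves invariant. -/
def beamSplitterSector (θ : ℝ) (N : ℕ) :
    Matrix (Sector N) (Sector N) ℂ :=
  NormedSpace.exp ((θ : ℂ) • beamSplitterGenerator.submatrix Subtype.val Subtype.val)

/-- `exp(θ (a†b - a b†)) |y⟩` for `y = (y₁, y₂)` with `y₁ + y₂ = N`. -/
def beamSplitterVec (θ : ℝ) (N : ℕ) (y : Sector N) : Hil (ℕ × ℕ) :=
  ∑ x, beamSplitterSector θ N x y • ket x.1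

theorem beamSplitterSector_unitary (θ : ℝ) (N : ℕ) :
    (beamSplitterSector θ N).conjTranspose * beamSplitterSector θ N = 1 := by
  unfold beamSplitterSector
  set A := (θ : ℂ) • beamSplitterGenerator.submatrix (Subtype.val : Sector N → ℕ × ℕ)
    Subtype.val with hA
  have h : A.conjTranspose = -A := by
    ext x y
    simp [hA, beamSplitterGenerator, creation]
    ring
  rw [← Matrix.exp_conjTranspose, h, ← Matrix.exp_add_of_commute _ _ (Commute.refl A).neg_left]
  simp

theorem inner_beamSplitterVec (θ : ℝ) (N M : ℕ) (y : Sector N)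
    (z : Sector M) :
    ⟪beamSplitterVec θ N y, beamSplitterVec θ M z⟫_ℂ = if y.1 = z.1 then 1 else 0 := by
  unfold beamSplitterVec
  simp only [sum_inner, inner_sum, inner_smul_left, inner_smul_right]
  by_cases hNM : N = M
  · subst hNM
    have h := congrFun (congrFun (beamSplitterSector_unitary θ N) y) z
    rw [Matrix.mul_apply, Matrix.one_apply] at h
    simp only [Subtype.ext_iff] at h
    rw [← h]
    refine Finset.sum_congr rfl fun x _ => ?_
    rw [Finset.sum_eq_single x]
    · rw [orthonormal_iff_ite.1 orthonormal_ket]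
      simp [mul_comm]
    · intro w _ hw
      rw [orthonormal_iff_ite.1 orthonormal_ket, if_neg fun h => hw (Subtype.ext h)]
      simp
    · simp
  · have hne : ∀ (x : Sector N) (w : Sector M), x.1 ≠ w.1 := by
      intro x w h
      have h1 := Finset.HasAntidiagonal.mem_antidiagonal.1 x.2
      have h2 := Finset.HasAntidiagonal.mem_antidiagonal.1 w.2
      rw [h] at h1
      exact hNM (h1.symm.trans h2)
    rw [if_neg (hne y z)]
    simp [orthonormal_iff_ite.1 orthonormal_ket, hne]

/-- The beam splitter `U_λ = exp[arccos(√λ) (a†b - a b†)]` on `ℓ²(ℕ) ⊗ ℓ²(ℕ)`, the direct sum of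
its restrictions to the sectors of fixed total photon number. -/
def beamSplitter (l : ℝ) : Hil (ℕ × ℕ) →ₗᵢ[ℂ] Hil (ℕ × ℕ) :=
  isometryOfOrthonormal
    (v := fun y => beamSplitterVec (Real.arccos (Real.sqrt l)) (y.1 + y.2) ⟨y, by simp⟩)
    (by
      rw [orthonormal_iff_ite]
      intro y z
      rw [inner_beamSplitterVec])

/-- The isometry `|ψ⟩ ↦ U_λ (|ψ⟩ ⊗ |0⟩_E)`. -/
def lossDilation (l : ℝ) : Hil ℕ →ₗᵢ[ℂ] Hil (ℕ × ℕ) :=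
  (beamSplitter l).comp (tensorKet (Equiv.refl (ℕ × ℕ)) 0)

/-- The pure-loss channel `E_λ(ρ) = Tr_E [U_λ (ρ ⊗ |0⟩⟨0|_E) U_λ†]`. -/
def pureLoss (l : ℝ) : TraceClass ℕ →ₗ[ℂ] TraceClass ℕ :=
  traceRight ℕ ℕ ∘ₗ conjMap (lossDilation l).toContinuousLinearMap


theorem continuous_beamSplitterSector (N : ℕ) :
    Continuous fun θ : ℝ => beamSplitterSector θ N := by
  let : NormedRing (Matrix (Sector N) (Sector N) ℂ) := Matrix.linftyOpNormedRing
  let : NormedAlgebra ℂ (Matrix (Sector N) (Sector N) ℂ) := Matrix.linftyOpNormedAlgebra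
  let : NormedAlgebra ℚ (Matrix (Sector N) (Sector N) ℂ) := NormedAlgebra.restrictScalars ℚ ℂ _
  unfold beamSplitterSector
  refine NormedSpace.exp_continuous.comp ?_
  exact (Complex.continuous_ofReal).smul continuous_const

theorem continuous_lossDilation_ket (n : ℕ) :
    Continuous fun l : ℝ => lossDilation l (ket n) := by
  have h : ∀ l : ℝ, lossDilation l (ket n) =
      beamSplitterVec (Real.arccos (Real.sqrt l)) (n + 0) ⟨(n, 0), by simp⟩ := by
    intro l
    change beamSplitter l (tensorKet (Equiv.refl (ℕ × ℕ)) 0 (ket n)) = _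
    rw [tensorKet_ket, beamSplitter, isometryOfOrthonormal_ket]
    rfl
  simp only [h, beamSplitterVec]
  refine continuous_finsetSum _ fun x _ => Continuous.smul (f := fun l : ℝ =>
    beamSplitterSector (Real.arccos (Real.sqrt l)) (n + 0) x ⟨(n, 0), by simp⟩) ?_ continuous_const
  have hc := (continuous_beamSplitterSector (n + 0)).comp
    (Real.continuous_arccos.comp Real.continuous_sqrt)
  exact hc.matrix_elem x _

theorem stronglyMeasurable_of_coord {Λ ι : Type} [MeasurableSpace Λ] [Countable ι]
    {f : Λ → Hil ι} (hf : ∀ i, StronglyMeasurable fun l => ⟪ket i, f l⟫_ℂ) :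
    StronglyMeasurable f := by
  refine stronglyMeasurable_of_tendsto (Filter.atTop : Filter (Finset ι))
    (f := fun s l => ∑ i ∈ s, ⟪ket i, f l⟫_ℂ • (ket i : Hil ι)) ?_ ?_
  · intro s
    exact Finset.stronglyMeasurable_fun_sum s fun i _ => (hf i).smul_const _
  · rw [tendsto_pi_nhds]
    intro l
    simp only [inner_ket]
    exact hasSum_ket (f l)

/-- `λ ↦ E_λ(ρ) x` is measurable. -/
theorem stronglyMeasurable_pureLoss (ρ : TraceClass ℕ) (x : Hil ℕ) :
    StronglyMeasurable fun l : ℝ => (pureLoss l ρ : BOp ℕ ℕ) x := by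
  have hV : ∀ n, StronglyMeasurable fun l : ℝ => lossDilation l (ket n) := fun n =>
    (continuous_lossDilation_ket n).stronglyMeasurable
  have hVad : ∀ y, StronglyMeasurable fun l : ℝ =>
      ((lossDilation l).toContinuousLinearMap†) y := by
    intro y
    refine stronglyMeasurable_of_coord fun i => ?_
    simp only [ContinuousLinearMap.adjoint_inner_right]
    exact (hV i).inner stronglyMeasurable_const
  refine stronglyMeasurable_of_coord fun i => ?_
  have hs : ∀ l : ℝ, HasSum (fun k => ⟪((lossDilation l).toContinuousLinearMap†)
        (tensorKet (Equiv.refl (ℕ × ℕ)) k (ket i)),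
      (ρ : BOp ℕ ℕ) (((lossDilation l).toContinuousLinearMap†)
        (tensorKet (Equiv.refl (ℕ × ℕ)) k x))⟫_ℂ)
      ⟪ket i, (pureLoss l ρ : BOp ℕ ℕ) x⟫_ℂ := by
    intro l
    have h := inner_tsum_block (Equiv.refl (ℕ × ℕ))
      (conjMap (lossDilation l).toContinuousLinearMap ρ).2 (ket i) x
    refine HasSum.congr_fun h fun k => ?_
    rw [block, ContinuousLinearMap.comp_apply, ContinuousLinearMap.adjoint_inner_right,
      ContinuousLinearMap.adjoint_inner_left]
    rfl
  refine stronglyMeasurable_of_tendsto (Filter.atTop : Filter (Finset ℕ))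
    (f := fun s l => ∑ k ∈ s, ⟪((lossDilation l).toContinuousLinearMap†)
        (tensorKet (Equiv.refl (ℕ × ℕ)) k (ket i)),
      (ρ : BOp ℕ ℕ) (((lossDilation l).toContinuousLinearMap†)
        (tensorKet (Equiv.refl (ℕ × ℕ)) k x))⟫_ℂ) ?_ ?_
  · intro s
    exact Finset.stronglyMeasurable_fun_sum s fun k _ =>
      (hVad _).inner ((ρ : BOp ℕ ℕ).continuous.comp_stronglyMeasurable (hVad _))
  · rw [tendsto_pi_nhds]
    exact fun l => hs l

/-- The trace of a positive operator of finite trace, as a real number. -/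
def reTrace {ι : Type} (P : BOp ι ι) : ℝ := ∑' i, (⟪ket i, P (ket i)⟫_ℂ).re

theorem reTrace_conj_le {ι κ : Type} {P : BOp ι ι} (hP : IsPosFiniteTrace P)
    (V : Hil ι →ₗᵢ[ℂ] Hil κ) :
    reTrace (V.toContinuousLinearMap ∘L P ∘L V.toContinuousLinearMap†) ≤ reTrace P := by
  have h0 : 0 ≤ reTrace P := tsum_nonneg fun i => IsPosFiniteTrace.re_nonneg hP.1 (ket i)
  refine (hP.conj V.toContinuousLinearMap).2.tsum_le_of_sum_le fun s => ?_
  refine (sum_conj_le hP _ s).trans ?_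
  have hn : ‖V.toContinuousLinearMap‖ ≤ 1 := V.norm_toContinuousLinearMap_le
  calc _ ≤ 1 ^ 2 * reTrace P :=
        mul_le_mul_of_nonneg_right (pow_le_pow_left₀ (norm_nonneg _) hn 2) h0
    _ = _ := by ring

theorem isPosFiniteTrace_pureLoss (l : ℝ) (ρ : TraceClass ℕ) (hρ : IsPosFiniteTrace ρ.1) :
    IsPosFiniteTrace (pureLoss l ρ : BOp ℕ ℕ) :=
  isPosFiniteTrace_tsum_block _ (hρ.conj (lossDilation l).toContinuousLinearMap)

theorem reTrace_partialTrace {ι κ γ : Type} (e : ι × κ ≃ γ) {P : BOp γ γ}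
    (hP : IsPosFiniteTrace P) : reTrace (∑' k, block e k P) = reTrace P := by
  have hT : P ∈ TraceClass γ := Submodule.subset_span hP
  have h : ∀ i, (⟪ket i, (∑' k, block e k P) (ket i)⟫_ℂ).re =
      ∑' k, (⟪ket (e (i, k)), P (ket (e (i, k)))⟫_ℂ).re := by
    intro i
    have := Complex.hasSum_re (inner_tsum_block e hT (ket i) (ket i))
    simpa only [inner_block] using this.tsum_eq.symm
  have hs : Summable fun x : ι × κ => (⟪ket (e x), P (ket (e x))⟫_ℂ).re :=
    hP.2.comp_injective e.injective
  unfold reTrace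
  simp only [h]
  rw [← hs.tsum_prod]
  exact e.tsum_eq fun g => (⟪ket g, P (ket g)⟫_ℂ).re

theorem reTrace_pureLoss_le (l : ℝ) (ρ : TraceClass ℕ) (hρ : IsPosFiniteTrace ρ.1) :
    reTrace (pureLoss l ρ : BOp ℕ ℕ) ≤ reTrace ρ.1 := by
  have h := reTrace_partialTrace (Equiv.refl (ℕ × ℕ))
    (hρ.conj (lossDilation l).toContinuousLinearMap)
  exact (le_of_eq h).trans (reTrace_conj_le hρ _)

theorem exists_bound_pureLoss (ρ : TraceClass ℕ) :
    ∃ C : ℝ, 0 ≤ C ∧ ∀ l : ℝ, ‖(pureLoss l ρ : BOp ℕ ℕ)‖ ≤ C := by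
  refine traceClass_induction (p := fun ρ => ∃ C : ℝ, 0 ≤ C ∧
    ∀ l : ℝ, ‖(pureLoss l ρ : BOp ℕ ℕ)‖ ≤ C) ?_ ?_ ?_ ?_ ρ
  · intro P hP
    refine ⟨reTrace P.1, tsum_nonneg fun i => IsPosFiniteTrace.re_nonneg hP.1 (ket i), fun l => ?_⟩
    exact (isPosFiniteTrace_pureLoss l P hP).norm_le.trans (reTrace_pureLoss_le l P hP)
  · refine ⟨0, le_rfl, fun l => ?_⟩
    rw [map_zero]
    exact le_of_eq norm_zero
  · rintro S T ⟨C, hC, h⟩ ⟨D, hD, k⟩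
    refine ⟨C + D, add_nonneg hC hD, fun l => ?_⟩
    rw [map_add]
    exact (norm_add_le _ _).trans (add_le_add (h l) (k l))
  · rintro c T ⟨C, hC, h⟩
    refine ⟨‖c‖ * C, mul_nonneg (norm_nonneg _) hC, fun l => ?_⟩
    rw [map_smul]
    change ‖c • (pureLoss l T : BOp ℕ ℕ)‖ ≤ _
    rw [norm_smul]
    exact mul_le_mul_of_nonneg_left (h l) (norm_nonneg _)

/-! ### Fading channels -/

theorem integrable_pureLoss (μ : Measure unitInterval) [IsFiniteMeasure μ] (ρ : TraceClass ℕ)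
    (x : Hil ℕ) : Integrable (fun l : unitInterval => (pureLoss (l : ℝ) ρ : BOp ℕ ℕ) x) μ := by
  obtain ⟨C, hC, h⟩ := exists_bound_pureLoss ρ
  refine Integrable.of_bound
    ((stronglyMeasurable_pureLoss ρ x).comp_measurable measurable_subtype_coe).aestronglyMeasurable
    (C * ‖x‖) (Filter.Eventually.of_forall fun l => ?_)
  exact ((pureLoss (l : ℝ) ρ : BOp ℕ ℕ).le_opNorm x).trans
    (mul_le_mul_of_nonneg_right (h l) (norm_nonneg x))

/-- The bounded operator `∫ E_λ(ρ) dμ(λ)`, the integral being taken in the strong operator topology: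
`(∫ E_λ(ρ) dμ(λ)) x = ∫ E_λ(ρ) x dμ(λ)`. -/
def fadingOp (μ : Measure unitInterval) [IsFiniteMeasure μ] (ρ : TraceClass ℕ) : BOp ℕ ℕ :=
  LinearMap.mkContinuousOfExistsBound
    { toFun := fun x => ∫ l : unitInterval, (pureLoss (l : ℝ) ρ : BOp ℕ ℕ) x ∂μ
      map_add' := fun x y => by
        simp only [map_add]
        exact integral_add (integrable_pureLoss μ ρ x) (integrable_pureLoss μ ρ y)
      map_smul' := fun c x => by
        simp only [map_smul, RingHom.id_apply]
        exact integral_smul c _ }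
    (by
      obtain ⟨C, hC, h⟩ := exists_bound_pureLoss ρ
      refine ⟨C * μ.real Set.univ, fun x => ?_⟩
      refine (norm_integral_le_of_norm_le_const (C := C * ‖x‖)
        (Filter.Eventually.of_forall fun l => ?_)).trans (le_of_eq (by ring))
      exact ((pureLoss (l : ℝ) ρ : BOp ℕ ℕ).le_opNorm x).trans
        (mul_le_mul_of_nonneg_right (h l) (norm_nonneg x)))

theorem fadingOp_apply (μ : Measure unitInterval) [IsFiniteMeasure μ] (ρ : TraceClass ℕ)
    (x : Hil ℕ) :
    fadingOp μ ρ x = ∫ l : unitInterval, (pureLoss (l : ℝ) ρ : BOp ℕ ℕ) x ∂μ :=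
  rfl

theorem inner_fadingOp (μ : Measure unitInterval) [IsFiniteMeasure μ] (ρ : TraceClass ℕ)
    (x y : Hil ℕ) :
    ⟪x, fadingOp μ ρ y⟫_ℂ =
      ∫ l : unitInterval, ⟪x, (pureLoss (l : ℝ) ρ : BOp ℕ ℕ) y⟫_ℂ ∂μ := by
  rw [fadingOp_apply]
  exact (integral_inner (integrable_pureLoss μ ρ y) x).symm

theorem isPosFiniteTrace_fadingOp (μ : Measure unitInterval) [IsFiniteMeasure μ]
    (ρ : TraceClass ℕ) (hρ : IsPosFiniteTrace ρ.1) : IsPosFiniteTrace (fadingOp μ ρ) := by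
  have hpos : (fadingOp μ ρ).IsPositive := by
    refine isPositive_of_re_nonneg fun x => ?_
    rw [inner_fadingOp]
    exact integral_nonneg fun l => (isPosFiniteTrace_pureLoss l ρ hρ).1.inner_nonneg_right x
  refine ⟨hpos, ?_⟩
  have hint : ∀ i, Integrable (fun l : unitInterval =>
      (⟪ket i, (pureLoss (l : ℝ) ρ : BOp ℕ ℕ) (ket i)⟫_ℂ).re) μ := fun i =>
    ((integrable_pureLoss μ ρ (ket i)).const_inner (𝕜 := ℂ) (ket i)).re
  have hre : ∀ i, (⟪ket i, fadingOp μ ρ (ket i)⟫_ℂ).re =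
      ∫ l : unitInterval, (⟪ket i, (pureLoss (l : ℝ) ρ : BOp ℕ ℕ) (ket i)⟫_ℂ).re ∂μ := by
    intro i
    rw [inner_fadingOp]
    exact (integral_re ((integrable_pureLoss μ ρ (ket i)).const_inner (𝕜 := ℂ) (ket i))).symm
  refine summable_of_sum_le (c := ∫ _ : unitInterval, reTrace ρ.1 ∂μ)
    (fun i => IsPosFiniteTrace.re_nonneg hpos (ket i)) fun s => ?_
  simp only [hre]
  rw [← integral_finsetSum _ fun i _ => hint i]
  refine integral_mono (integrable_finsetSum _ fun i _ => hint i) (integrable_const _) fun l => ?_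
  have hp := isPosFiniteTrace_pureLoss l ρ hρ
  exact (hp.2.sum_le_tsum s fun i _ => IsPosFiniteTrace.re_nonneg hp.1 (ket i)).trans
    (reTrace_pureLoss_le l ρ hρ)

theorem fadingOp_add (μ : Measure unitInterval) [IsFiniteMeasure μ] (ρ σ : TraceClass ℕ) :
    fadingOp μ (ρ + σ) = fadingOp μ ρ + fadingOp μ σ := by
  ext1 x
  rw [add_apply, fadingOp_apply, fadingOp_apply, fadingOp_apply,
    ← integral_add (integrable_pureLoss μ ρ x) (integrable_pureLoss μ σ x)]
  simp only [map_add]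
  rfl

theorem fadingOp_smul (μ : Measure unitInterval) [IsFiniteMeasure μ] (c : ℂ) (ρ : TraceClass ℕ) :
    fadingOp μ (c • ρ) = c • fadingOp μ ρ := by
  ext1 x
  rw [smul_apply, fadingOp_apply, fadingOp_apply, ← integral_smul]
  simp only [map_smul]
  rfl

theorem fadingOp_mem (μ : Measure unitInterval) [IsFiniteMeasure μ] (ρ : TraceClass ℕ) :
    fadingOp μ ρ ∈ TraceClass ℕ := by
  refine traceClass_induction (p := fun ρ => fadingOp μ ρ ∈ TraceClass ℕ) ?_ ?_ ?_ ?_ ρ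
  · exact fun P hP => Submodule.subset_span (isPosFiniteTrace_fadingOp μ P hP)
  · have h := fadingOp_smul μ 0 0
    rw [zero_smul, zero_smul] at h
    rw [h]
    exact Submodule.zero_mem _
  · intro S T h1 h2
    rw [fadingOp_add]
    exact Submodule.add_mem _ h1 h2
  · intro c T h1
    rw [fadingOp_smul]
    exact Submodule.smul_mem _ c h1

/-- The fading channel `Φ_μ(ρ) = ∫ E_λ(ρ) dμ(λ)` for a distribution `μ` of the transmissivity
`λ ∈ [0, 1]`. -/
def fadingChannel (μ : Measure unitInterval) [IsFiniteMeasure μ] :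
    TraceClass ℕ →ₗ[ℂ] TraceClass ℕ where
  toFun ρ := ⟨fadingOp μ ρ, fadingOp_mem μ ρ⟩
  map_add' ρ σ := Subtype.ext (fadingOp_add μ ρ σ)
  map_smul' c ρ := Subtype.ext (fadingOp_smul μ c ρ)

/-- For a finitely supported distribution, `Φ_μ = ∑ₙ pₙ E_{λₙ}`. -/
theorem fadingChannel_finite {d : ℕ} (p : Fin d → NNReal) (l : Fin d → unitInterval) :
    fadingChannel (∑ n, p n • Measure.dirac (l n)) = ∑ n, (p n : ℂ) • pureLoss (l n : ℝ) := by
  ext1 ρ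
  refine Subtype.ext (ContinuousLinearMap.ext fun x => ?_)
  change fadingOp _ ρ x = _
  rw [fadingOp_apply, integral_finsetSum_measure fun n _ => integrable_pureLoss _ ρ x]
  simp only [integral_smul_nnreal_measure, integral_dirac]
  simp [LinearMap.sum_apply]
  rfl

/-! ### The restriction to the qubit subspace -/

/-- The inclusion of the qubit `ℂ²` into the mode as `span {|0⟩, |1⟩}`. -/
def qubitInclusion : Hil (Fin 2) →ₗᵢ[ℂ] Hil ℕ :=
  isometryOfOrthonormal (v := fun i : Fin 2 => ket (i : ℕ))
    (orthonormal_ket.comp _ Fin.val_injective)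

/-- Operators on the qubit, regarded as operators on the subspace `span {|0⟩, |1⟩}` of the mode. -/
def qubitEmbed : TraceClass (Fin 2) →ₗ[ℂ] TraceClass ℕ :=
  conjMap qubitInclusion.toContinuousLinearMap

/-- The restriction `Φ₂` of `Φ` to operators on `span {|0⟩, |1⟩}`, with the output compressed to
`span {|0⟩, |1⟩}`. -/
def qubitRestriction (Φ : TraceClass ℕ →ₗ[ℂ] TraceClass ℕ) :
    TraceClass (Fin 2) →ₗ[ℂ] TraceClass (Fin 2) :=
  conjMap (qubitInclusion.toContinuousLinearMap†) ∘ₗ Φ ∘ₗ qubitEmbed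

end

/-!
A Stinespring isometry `V` of a channel `Φ` gives the vectors `v i m = (⟨m| ⊗ 1) V |i⟩` of the
environment (`envVec`). The Choi matrix of `Φ` is their Gram matrix (`inner_traceRight_ketBra`), so
its rank is at most the dimension of any space that contains them. The complementary channel maps
`|i⟩⟨i|` to `∑ₘ |v i m⟩⟨v i m|`.

Let `Φ` be a degradable channel with qubit input and output. If, for some `i`, the vectors `v i 0`
and `v i 1` are linearly independent, then `Φ(|i⟩⟨i|)` has full rank and hence dominates a multiple
of every state of the output qubit. A degrading map preserves such inequalities, so all environment
states are supported on the span of `v i 0` and `v i 1`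
(`envVec_mem_span_of_linearIndependent`). Otherwise each `V |i⟩` is a product vector and contributes
at most one dimension. In both cases the `v i m` span at most two dimensions. The argument is
carried out for qubit subspaces of arbitrary systems (`rank_choi_le_two_of_isDegradable`), which
makes it apply directly to channels on a bosonic mode.

On at most one photon the generator of the beam splitter squares to `-1`, so that
`U_λ |1, 0⟩ = √λ |1, 0⟩ - √(1 - λ) |0, 1⟩`. This gives the Choi matrix of a pure-loss channel on the
qubit subspace and, by integration, that of a fading channel. The latter has rank `3` as soon as
`(1 - ⟨λ⟩) (⟨λ⟩ - ⟨√λ⟩²)` does not vanish. The second factor is the variance of `√λ`, so for a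
distribution that is not a Dirac measure both factors are positive, and the channel is not
degradable.
-/

/-! ### Matrix elements of a channel and its complement -/

/-- Matrix elements of a partial trace of `A |i⟩⟨j| A†`. -/
theorem hasSum_inner_partialTrace_ketBra {α ι κ γ : Type} (e : ι × κ ≃ γ) (A : BOp α γ) (i j : α)
    (x y : Hil ι) :
    HasSum (fun k => ⟪tensorKet e k x, A (ket i)⟫_ℂ * ⟪A (ket j), tensorKet e k y⟫_ℂ)
      ⟪x, (partialTrace e (conjMap A (ketBra i j)) : BOp ι ι) y⟫_ℂ := by
  have h := inner_tsum_block e (conjMap A (ketBra i j)).2 x y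
  refine HasSum.congr_fun h fun k => ?_
  rw [block, ContinuousLinearMap.comp_apply, ContinuousLinearMap.adjoint_inner_right]
  change _ = ⟪tensorKet e k x, A (InnerProductSpace.rankOne ℂ (ket i) (ket j)
    ((A†) (tensorKet e k y)))⟫_ℂ
  rw [InnerProductSpace.rankOne_apply, map_smul, inner_smul_right,
    ContinuousLinearMap.adjoint_inner_right, mul_comm]

/-- The vector `(⟨m| ⊗ 1) V |i⟩` of the environment, for a Stinespring isometry `V`. -/
noncomputable def envVec {ι κ ε : Type} (V : Hil ι →ₗᵢ[ℂ] Hil (κ × ε)) (i : ι) (m : κ) : Hil ε :=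
  ((tensorKet (Equiv.prodComm ε κ) m).toContinuousLinearMap†) (V (ket i))

theorem inner_envVec {ι κ ε : Type} (V : Hil ι →ₗᵢ[ℂ] Hil (κ × ε)) (i : ι) (m : κ) (u : Hil ε) :
    ⟪u, envVec V i m⟫_ℂ = ⟪tensorKet (Equiv.prodComm ε κ) m u, V (ket i)⟫_ℂ := by
  rw [envVec, ContinuousLinearMap.adjoint_inner_right]
  rfl

theorem envVec_apply {ι κ ε : Type} (V : Hil ι →ₗᵢ[ℂ] Hil (κ × ε)) (i : ι) (m : κ) (k : ε) :
    envVec V i m k = V (ket i) (m, k) := by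
  rw [← inner_ket, inner_envVec, tensorKet_ket, inner_ket]
  rfl

/-- The Choi matrix of a channel is a Gram matrix of vectors of the environment. -/
theorem inner_traceRight_ketBra {ι κ ε : Type} (V : Hil ι →ₗᵢ[ℂ] Hil (κ × ε)) (i j : ι)
    (m n : κ) :
    ⟪ket m, (traceRight κ ε (conjMap V.toContinuousLinearMap (ketBra i j)) : BOp κ κ) (ket n)⟫_ℂ =
      ⟪envVec V j n, envVec V i m⟫_ℂ := by
  refine (hasSum_inner_partialTrace_ketBra (Equiv.refl (κ × ε)) V.toContinuousLinearMap i j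
    (ket m) (ket n)).unique ?_
  refine HasSum.congr_fun (lp.hasSum_inner (envVec V j n) (envVec V i m)) fun k => ?_
  rw [tensorKet_ket, tensorKet_ket, inner_ket, ← inner_conj_symm (V.toContinuousLinearMap (ket j)),
    inner_ket, envVec_apply, envVec_apply, RCLike.inner_apply]
  rfl

/-- The quadratic form of `Tr_E (V |i⟩⟨i| V†)`, when the output is supported on the span of the
`|g a⟩`. -/
theorem inner_traceRight_ketBra_self {ι κ ε η : Type} [Fintype η] (V : Hil ι →ₗᵢ[ℂ] Hil (κ × ε))
    (i : ι) {g : η → κ} (hg : Function.Injective g)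
    (hsupp : ∀ m ∉ Set.range g, envVec V i m = 0) (y : Hil κ) :
    ⟪y, (traceRight κ ε (conjMap V.toContinuousLinearMap (ketBra i i)) : BOp κ κ) y⟫_ℂ =
      ((‖∑ a, star (y (g a)) • envVec V i (g a)‖ ^ 2 : ℝ) : ℂ) := by
  set w := ∑ a, star (y (g a)) • envVec V i (g a) with hw
  have hk : ∀ k, ⟪tensorKet (Equiv.refl (κ × ε)) k y, V (ket i)⟫_ℂ = w k := by
    intro k
    have h1 : ⟪tensorKet (Equiv.refl (κ × ε)) k y, V (ket i)⟫_ℂ =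
        ⟪y, ((tensorKet (Equiv.refl (κ × ε)) k).toContinuousLinearMap†) (V (ket i))⟫_ℂ := by
      rw [ContinuousLinearMap.adjoint_inner_right]
      rfl
    have h2 : ∀ m, (((tensorKet (Equiv.refl (κ × ε)) k).toContinuousLinearMap†) (V (ket i))) m =
        envVec V i m k := by
      intro m
      rw [← inner_ket, ContinuousLinearMap.adjoint_inner_right, envVec_apply, ← inner_ket]
      exact congrArg (fun z => ⟪z, V (ket i)⟫_ℂ) (tensorKet_ket _ _ _)
    have h3 := lp.hasSum_inner (𝕜 := ℂ) y
      (((tensorKet (Equiv.refl (κ × ε)) k).toContinuousLinearMap†) (V (ket i)))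
    rw [← h1] at h3
    have h4 := (hg.hasSum_iff (fun m hm => by
      rw [h2, hsupp m hm]; simp)).2 h3
    rw [h4.unique (hasSum_fintype _), hw]
    rw [lp.coeFn_sum, Finset.sum_apply]
    refine Finset.sum_congr rfl fun a _ => ?_
    rw [Function.comp_apply, h2, RCLike.inner_apply, lp.coeFn_smul, Pi.smul_apply, smul_eq_mul,
      mul_comm]
    rfl
  have h := hasSum_inner_partialTrace_ketBra (Equiv.refl (κ × ε)) V.toContinuousLinearMap i i y y
  refine h.unique ?_
  have hn : ⟪w, w⟫_ℂ = ((‖w‖ ^ 2 : ℝ) : ℂ) := by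
    rw [inner_self_eq_norm_sq_to_K]
    simp
  rw [← hn]
  refine HasSum.congr_fun (lp.hasSum_inner w w) fun k => ?_
  rw [← inner_conj_symm (V.toContinuousLinearMap (ket i))]
  change ⟪tensorKet (Equiv.refl (κ × ε)) k y, V (ket i)⟫_ℂ *
    (starRingEnd ℂ) ⟪tensorKet (Equiv.refl (κ × ε)) k y, V (ket i)⟫_ℂ = _
  rw [hk, RCLike.inner_apply]

/-- The quadratic form of `Tr_S (V |i⟩⟨i| V†) = ∑ₘ |vₘ⟩⟨vₘ|` with `vₘ = (⟨m| ⊗ 1) V |i⟩`. -/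
theorem hasSum_inner_traceLeft_ketBra_self {ι κ ε : Type} (V : Hil ι →ₗᵢ[ℂ] Hil (κ × ε)) (i : ι)
    (u : Hil ε) :
    HasSum (fun m => ‖⟪u, envVec V i m⟫_ℂ‖ ^ 2)
      (⟪u, (traceLeft κ ε (conjMap V.toContinuousLinearMap (ketBra i i)) : BOp ε ε) u⟫_ℂ).re := by
  have h := Complex.hasSum_re (hasSum_inner_partialTrace_ketBra (Equiv.prodComm ε κ)
    V.toContinuousLinearMap i i u u)
  refine HasSum.congr_fun h fun m => ?_
  rw [inner_envVec, ← inner_conj_symm (V.toContinuousLinearMap (ket i))]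
  change _ = (⟪tensorKet (Equiv.prodComm ε κ) m u, V (ket i)⟫_ℂ *
    (starRingEnd ℂ) ⟪tensorKet (Equiv.prodComm ε κ) m u, V (ket i)⟫_ℂ).re
  rw [Complex.mul_conj']
  norm_cast

/-! ### Degradable channels with qubit input and output -/

/-- A linearly independent finite family dominates any other family with the same index type. -/
theorem exists_norm_sum_smul_le {E η : Type} [NormedAddCommGroup E] [NormedSpace ℂ E] [Fintype η]
    {v : η → E} (hv : LinearIndependent ℂ v) (w : η → E) :
    ∃ C : ℝ, ∀ c : η → ℂ, ‖∑ a, c a • w a‖ ^ 2 ≤ C * ‖∑ a, c a • v a‖ ^ 2 := by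
  obtain ⟨K, -, hK⟩ := (Fintype.linearCombination ℂ v).exists_antilipschitzWith
    (LinearMap.ker_eq_bot.2 (linearIndependent_iff_injective_fintypeLinearCombination.1 hv))
  set B := LinearMap.toContinuousLinearMap (Fintype.linearCombination ℂ w) with hB
  refine ⟨(‖B‖ * K) ^ 2, fun c => ?_⟩
  rw [← mul_pow]
  refine pow_le_pow_left₀ (norm_nonneg _) ?_ 2
  have h1 : ‖∑ a, c a • w a‖ ≤ ‖B‖ * ‖c‖ := by
    simpa [hB, Fintype.linearCombination_apply] using B.le_opNorm c
  have h2 : ‖c‖ ≤ K * ‖∑ a, c a • v a‖ := by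
    simpa [Fintype.linearCombination_apply, dist_zero_right] using hK.le_mul_dist c 0
  calc _ ≤ ‖B‖ * ‖c‖ := h1
    _ ≤ ‖B‖ * (K * ‖∑ a, c a • v a‖) := mul_le_mul_of_nonneg_left h2 (norm_nonneg _)
    _ = _ := by ring

theorem IsQuantumChannel.inner_nonneg {ι κ : Type} {D : TraceClass ι →ₗ[ℂ] TraceClass κ}
    (hD : IsQuantumChannel D) {T : TraceClass ι} (hT : ∀ x, 0 ≤ ⟪x, (T : BOp ι ι) x⟫_ℂ)
    (u : Hil κ) : 0 ≤ ⟪u, (D T : BOp κ κ) u⟫_ℂ := by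
  have h := hD.1 1 (fun _ _ => T) (fun v => by simpa using hT (v 0)) (fun _ => u)
  simpa using h

/-- If `Φ(|i⟩⟨i|)` has full rank on an output space that also supports `Φ(|j⟩⟨j|)`, then
`Φ(|j⟩⟨j|) ≤ C Φ(|i⟩⟨i|)`. A degrading map preserves this inequality, so the environment state for
`|j⟩` is supported on the support of the environment state for `|i⟩`. -/
theorem envVec_mem_span_of_linearIndependent {ι κ ε η : Type} [Fintype η]
    (V : Hil ι →ₗᵢ[ℂ] Hil (κ × ε)) {D : TraceClass κ →ₗ[ℂ] TraceClass ε}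
    (hD : IsQuantumChannel D)
    (hV : traceLeft κ ε ∘ₗ conjMap V.toContinuousLinearMap =
      D ∘ₗ (traceRight κ ε ∘ₗ conjMap V.toContinuousLinearMap))
    {g : η → κ} (hg : Function.Injective g) {i j : ι}
    (hi : ∀ m ∉ Set.range g, envVec V i m = 0) (hj : ∀ m ∉ Set.range g, envVec V j m = 0)
    (hv : LinearIndependent ℂ fun a => envVec V i (g a)) (m : κ) :
    envVec V j m ∈ Submodule.span ℂ (Set.range fun a => envVec V i (g a)) := by
  set W := Submodule.span ℂ (Set.range fun a => envVec V i (g a)) with hW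
  have : FiniteDimensional ℂ W := FiniteDimensional.span_of_finite ℂ (Set.finite_range _)
  rw [← W.orthogonal_orthogonal, Submodule.mem_orthogonal]
  intro u hu
  obtain ⟨C, hC⟩ := exists_norm_sum_smul_le hv fun a => envVec V j (g a)
  set Φ := traceRight κ ε ∘ₗ conjMap V.toContinuousLinearMap with hΦ
  have hpos : ∀ y, 0 ≤ ⟪y, (((C : ℂ) • Φ (ketBra i i) - Φ (ketBra j j) : TraceClass κ) :
      BOp κ κ) y⟫_ℂ := by
    intro y
    have h : ⟪y, (((C : ℂ) • Φ (ketBra i i) - Φ (ketBra j j) : TraceClass κ) : BOp κ κ) y⟫_ℂ =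
        C * ⟪y, (Φ (ketBra i i) : BOp κ κ) y⟫_ℂ - ⟪y, (Φ (ketBra j j) : BOp κ κ) y⟫_ℂ := by
      rw [← inner_smul_right, ← inner_sub_right]
      rfl
    rw [h, hΦ, LinearMap.comp_apply, LinearMap.comp_apply, inner_traceRight_ketBra_self V i hg hi,
      inner_traceRight_ketBra_self V j hg hj, ← Complex.ofReal_mul, ← Complex.ofReal_sub,
      Complex.zero_le_real]
    exact sub_nonneg.2 (hC _)
  -- `D` maps the inequality to the complementary channel, whose value at `|i⟩⟨i|` vanishes on `u`.
  have h := hD.inner_nonneg hpos u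
  have h2 : ⟪u, (D ((C : ℂ) • Φ (ketBra i i) - Φ (ketBra j j)) : BOp ε ε) u⟫_ℂ =
      C * ⟪u, (traceLeft κ ε (conjMap V.toContinuousLinearMap (ketBra i i)) : BOp ε ε) u⟫_ℂ -
        ⟪u, (traceLeft κ ε (conjMap V.toContinuousLinearMap (ketBra j j)) : BOp ε ε) u⟫_ℂ := by
    rw [map_sub, map_smul, ← LinearMap.comp_apply D, ← LinearMap.comp_apply D, ← hV,
      ← inner_smul_right, ← inner_sub_right]
    rfl
  rw [h2] at h
  have h3 := (Complex.le_def.1 h).1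
  rw [Complex.sub_re, Complex.re_ofReal_mul] at h3
  have hzero : (⟪u, (traceLeft κ ε (conjMap V.toContinuousLinearMap (ketBra i i)) :
      BOp ε ε) u⟫_ℂ).re = 0 := by
    refine (hasSum_inner_traceLeft_ketBra_self V i u).unique ?_
    refine hasSum_zero.congr_fun fun n => ?_
    have : ⟪u, envVec V i n⟫_ℂ = 0 := by
      by_cases hn : n ∈ Set.range g
      · obtain ⟨a, rfl⟩ := hn
        exact Submodule.inner_left_of_mem_orthogonal (K := W)
          (Submodule.subset_span (Set.mem_range_self a)) hu
      · rw [hi n hn, inner_zero_right]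
    rw [this]
    simp
  have hs := hasSum_inner_traceLeft_ketBra_self V j u
  have hle := le_hasSum hs m fun n _ => sq_nonneg _
  rw [hzero, mul_zero, zero_sub, Complex.zero_re] at h3
  have h0 : ‖⟪u, envVec V j m⟫_ℂ‖ ^ 2 = 0 := le_antisymm (by linarith) (sq_nonneg _)
  simpa using h0

/-- The Gram matrix of vectors of `W` factors, as a linear map, through `W`. -/
theorem rank_gram_transpose_le {E ν : Type} [NormedAddCommGroup E] [InnerProductSpace ℂ E]
    [Fintype ν] (v : ν → E) (W : Submodule ℂ E) [FiniteDimensional ℂ W] (hv : ∀ x, v x ∈ W) :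
    (Matrix.of fun x y => ⟪v y, v x⟫_ℂ).rank ≤ Module.finrank ℂ W := by
  rw [← Matrix.rank_transpose, Matrix.rank]
  set T : E →ₗ[ℂ] ν → ℂ := LinearMap.pi fun x => (innerSL ℂ (v x)).toLinearMap with hT
  refine le_trans (Submodule.finrank_mono (t := W.map T) ?_) (Submodule.finrank_map_le T W)
  rintro _ ⟨c, rfl⟩
  refine ⟨∑ y, c y • v y, Submodule.sum_mem _ fun y _ => W.smul_mem _ (hv y), ?_⟩
  ext x
  simp [hT, Matrix.vecMul, dotProduct]

/-- A degradable channel that maps a qubit subspace of its input to a qubit subspace of its output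
has, on these subspaces, a Choi matrix of rank at most `2`. -/
theorem rank_choi_le_two_of_isDegradable {ι κ : Type} {Φ : TraceClass ι →ₗ[ℂ] TraceClass κ}
    (hΦ : IsDegradable Φ) (f : Fin 2 → ι) {g : Fin 2 → κ} (hg : Function.Injective g)
    (hsupp : ∀ a, ∀ m ∉ Set.range g, ⟪ket m, (Φ (ketBra (f a) (f a)) : BOp κ κ) (ket m)⟫_ℂ = 0) :
    (Matrix.of fun x y : Fin 2 × Fin 2 =>
      ⟪ket (g x.2), (Φ (ketBra (f x.1) (f y.1)) : BOp κ κ) (ket (g y.2))⟫_ℂ).rank ≤ 2 := by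
  obtain ⟨ε, Ψ, ⟨V, rfl, rfl⟩, D, hD, hV⟩ := hΦ
  have hzero : ∀ a, ∀ m ∉ Set.range g, envVec V (f a) m = 0 := by
    intro a m hm
    have h := hsupp a m hm
    rwa [LinearMap.comp_apply, inner_traceRight_ketBra, inner_self_eq_zero] at h
  simp only [LinearMap.comp_apply, inner_traceRight_ketBra]
  suffices ∃ W : Submodule ℂ (Hil ε), FiniteDimensional ℂ W ∧ Module.finrank ℂ W ≤ 2 ∧
      ∀ a b, envVec V (f a) (g b) ∈ W by
    obtain ⟨W, hfin, hW, hmem⟩ := this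
    exact (rank_gram_transpose_le (fun x : Fin 2 × Fin 2 => envVec V (f x.1) (g x.2)) W
      fun x => hmem _ _).trans hW
  set S : Fin 2 → Submodule ℂ (Hil ε) := fun a =>
    Submodule.span ℂ (Set.range fun b => envVec V (f a) (g b)) with hS
  have hfin : ∀ a, FiniteDimensional ℂ (S a) := fun a =>
    FiniteDimensional.span_of_finite ℂ (Set.finite_range _)
  by_cases hli : ∃ a, LinearIndependent ℂ fun b => envVec V (f a) (g b)
  · obtain ⟨a, ha⟩ := hli
    refine ⟨S a, hfin a, ?_, fun a' b => ?_⟩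
    · exact (finrank_range_le_card _).trans (by simp)
    · exact envVec_mem_span_of_linearIndependent V hD hV hg (hzero a) (hzero a') ha _
  · -- Both `V |f 0⟩` and `V |f 1⟩` are then product vectors: each family spans at most a line.
    push Not at hli
    have h1 : ∀ a, Module.finrank ℂ (S a) ≤ 1 := by
      intro a
      have hle : Module.finrank ℂ (S a) ≤ 2 := (finrank_range_le_card _).trans (by simp)
      have hne : Module.finrank ℂ (S a) ≠ 2 := fun h => hli a
        (linearIndependent_iff_card_eq_finrank_span.2 (by rw [Fintype.card_fin]; exact h.symm))
      omega
    refine ⟨S 0 ⊔ S 1, inferInstance, ?_, fun a b => ?_⟩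
    · exact (Submodule.finrank_add_le_finrank_add_finrank _ _).trans
        (Nat.add_le_add (h1 0) (h1 1))
    · have hab : envVec V (f a) (g b) ∈ S a := Submodule.subset_span ⟨b, rfl⟩
      fin_cases a
      · exact Submodule.mem_sup_left hab
      · exact Submodule.mem_sup_right hab

theorem rank_choiMatrix_le_two_of_isDegradable {Φ : TraceClass (Fin 2) →ₗ[ℂ] TraceClass (Fin 2)}
    (hΦ : IsDegradable Φ) : (choiMatrix Φ).rank ≤ 2 := by
  have h := rank_choi_le_two_of_isDegradable hΦ id Function.injective_id
    fun _ m hm => absurd (Set.mem_range_self m) hm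
  simpa only [choiMatrix, id_eq] using h

/-! ### The beam splitter on at most one photon -/

/-- If `G² = -1`, then `exp (θ G) = cos θ + sin θ G`: the map `i ↦ G` extends to an algebra
homomorphism from `ℂ`. -/
theorem Matrix.exp_smul_of_sq_eq_neg_one {ν : Type} [Fintype ν] [DecidableEq ν]
    {G : Matrix ν ν ℂ} (hG : G * G = -1) (θ : ℝ) :
    NormedSpace.exp ((θ : ℂ) • G) =
      (Real.cos θ : ℂ) • (1 : Matrix ν ν ℂ) + (Real.sin θ : ℂ) • G := by
  let : NormedRing (Matrix ν ν ℂ) := Matrix.linftyOpNormedRing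
  let : NormedAlgebra ℂ (Matrix ν ν ℂ) := Matrix.linftyOpNormedAlgebra
  set F : ℂ →ₐ[ℝ] Matrix ν ν ℂ := Complex.liftAux G hG with hF
  have hc : Continuous F := F.toLinearMap.continuous_of_finiteDimensional
  have h1 := NormedSpace.map_exp F hc (θ * Complex.I)
  have h2 : F (θ * Complex.I) = (θ : ℂ) • G := by
    rw [hF, Complex.liftAux_apply]
    ext x y
    simp
  rw [← h2]
  refine Eq.trans h1.symm ?_
  rw [← Complex.exp_eq_exp_ℂ, hF, Complex.liftAux_apply, Complex.exp_ofReal_mul_I_re,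
    Complex.exp_ofReal_mul_I_im]
  ext x y
  simp [Matrix.algebraMap_matrix_apply, Matrix.one_apply]

theorem beamSplitterSector_zero (θ : ℝ) : beamSplitterSector θ 0 = 1 := by
  have h : beamSplitterGenerator.submatrix (Subtype.val : Sector 0 → ℕ × ℕ)
      (Subtype.val : Sector 0 → ℕ × ℕ) = 0 := by
    ext ⟨x, hx⟩ ⟨y, hy⟩
    obtain rfl : x = (0, 0) := by simpa using hx
    obtain rfl : y = (0, 0) := by simpa using hy
    simp [beamSplitterGenerator, creation, annihilation]
  rw [beamSplitterSector, h, smul_zero, NormedSpace.exp_zero]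

theorem beamSplitterGenerator_sq_sector_one :
    beamSplitterGenerator.submatrix (Subtype.val : Sector 1 → ℕ × ℕ)
        (Subtype.val : Sector 1 → ℕ × ℕ) *
      beamSplitterGenerator.submatrix (Subtype.val : Sector 1 → ℕ × ℕ)
        (Subtype.val : Sector 1 → ℕ × ℕ) = -1 := by
  have hanti : ∀ x : ℕ × ℕ, x ∈ Finset.HasAntidiagonal.antidiagonal 1 →
      x = (0, 1) ∨ x = (1, 0) := by
    intro x hx
    simpa [Finset.Nat.antidiagonal_succ] using hx
  ext ⟨x, hx⟩ ⟨y, hy⟩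
  rw [Matrix.mul_apply]
  simp only [Matrix.submatrix_apply]
  rw [Finset.sum_coe_sort (Finset.HasAntidiagonal.antidiagonal 1)
    fun z => beamSplitterGenerator x z * beamSplitterGenerator z y]
  rcases hanti x hx with rfl | rfl <;> rcases hanti y hy with rfl | rfl <;>
    simp [Finset.Nat.antidiagonal_succ, beamSplitterGenerator, creation, annihilation]

theorem beamSplitterVec_one (θ : ℝ) (h : (1, 0) ∈ Finset.HasAntidiagonal.antidiagonal 1) :
    beamSplitterVec θ 1 ⟨(1, 0), h⟩ =
      (Real.cos θ : ℂ) • ket (1, 0) - (Real.sin θ : ℂ) • ket (0, 1) := by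
  unfold beamSplitterVec beamSplitterSector
  rw [Matrix.exp_smul_of_sq_eq_neg_one beamSplitterGenerator_sq_sector_one]
  simp only [Matrix.add_apply, Matrix.smul_apply, Matrix.one_apply, Matrix.submatrix_apply,
    Subtype.ext_iff]
  rw [Finset.sum_coe_sort (Finset.HasAntidiagonal.antidiagonal 1)
    fun z => ((Real.cos θ : ℂ) • (if z = (1, 0) then (1 : ℂ) else 0) +
      (Real.sin θ : ℂ) • beamSplitterGenerator z (1, 0)) • (ket z : Hil (ℕ × ℕ))]
  simp [Finset.Nat.antidiagonal_succ, beamSplitterGenerator, creation, annihilation]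
  abel

theorem lossDilation_ket (l : ℝ) (n : ℕ) : lossDilation l (ket n) =
    beamSplitterVec (Real.arccos (Real.sqrt l)) (n + 0) ⟨(n, 0), by simp⟩ := by
  change beamSplitter l (tensorKet (Equiv.refl (ℕ × ℕ)) 0 (ket n)) = _
  rw [tensorKet_ket, beamSplitter, isometryOfOrthonormal_ket]
  rfl

theorem lossDilation_ket_zero (l : ℝ) : lossDilation l (ket 0) = ket (0, 0) := by
  rw [lossDilation_ket]
  change beamSplitterVec _ 0 _ = _
  unfold beamSplitterVec
  rw [beamSplitterSector_zero, Finset.sum_eq_single ⟨(0, 0), by simp⟩]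
  · simp
  · rintro ⟨x, hx⟩ - hne
    exact absurd (Subtype.ext (by simpa using hx)) hne
  · exact fun h => absurd (Finset.mem_univ _) h

theorem lossDilation_ket_one (l : unitInterval) : lossDilation l (ket 1) =
    (Real.sqrt l : ℂ) • ket (1, 0) - (Real.sqrt (1 - l) : ℂ) • ket (0, 1) := by
  rw [lossDilation_ket]
  refine (beamSplitterVec_one _ (by simp)).trans ?_
  rw [Real.cos_arccos (by linarith [Real.sqrt_nonneg (l : ℝ)]) (Real.sqrt_le_one.2 l.2.2),
    Real.sin_arccos, Real.sq_sqrt l.2.1]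

/-! ### Fading channels on the qubit subspace -/

theorem envVec_lossDilation_zero (l : ℝ) (m : ℕ) :
    envVec (lossDilation l) 0 m = if m = 0 then ket 0 else 0 := by
  ext k
  rw [envVec_apply, lossDilation_ket_zero, ket_apply]
  split_ifs with h1 h2 h2 <;> simp_all [ket_apply]

theorem envVec_lossDilation_one (l : unitInterval) (m : ℕ) :
    envVec (lossDilation l) 1 m =
      if m = 0 then -(Real.sqrt (1 - l) : ℂ) • ket 1
      else if m = 1 then (Real.sqrt l : ℂ) • ket 0 else 0 := by
  ext k
  rw [envVec_apply, lossDilation_ket_one, lp.coeFn_sub, Pi.sub_apply, lp.coeFn_smul, lp.coeFn_smul,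
    Pi.smul_apply, Pi.smul_apply, ket_apply, ket_apply]
  split_ifs with h1 h2 h2 <;> simp_all [ket_apply, lp.coeFn_smul, -Complex.coe_smul, -neg_smul]

theorem inner_pureLoss_ketBra (l : ℝ) (i j m n : ℕ) :
    ⟪ket m, (pureLoss l (ketBra i j) : BOp ℕ ℕ) (ket n)⟫_ℂ =
      ⟪envVec (lossDilation l) j n, envVec (lossDilation l) i m⟫_ℂ :=
  inner_traceRight_ketBra _ _ _ _ _

/-- An operator is determined by its matrix elements. -/
theorem BOp.ext_inner_ket {ι κ : Type} {S T : BOp ι κ}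
    (h : ∀ i j, ⟪ket i, S (ket j)⟫_ℂ = ⟪ket i, T (ket j)⟫_ℂ) : S = T := by
  ext1 x
  have hj : ∀ j, S (ket j) = T (ket j) := by
    intro j
    ext i
    simpa only [inner_ket] using h i j
  have hS := S.hasSum (hasSum_ket x)
  have hT := T.hasSum (hasSum_ket x)
  simp only [map_smul, hj] at hS hT
  exact hS.unique hT

theorem eq_sum_smul_ketBra {ι : Type} [Fintype ι] (ρ : TraceClass ι) :
    ρ = ∑ a, ∑ b, ⟪ket a, (ρ : BOp ι ι) (ket b)⟫_ℂ • ketBra a b := by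
  classical
  refine Subtype.ext (BOp.ext_inner_ket fun i j => ?_)
  simp only [Submodule.coe_sum, Submodule.coe_smul, sum_apply,
    smul_apply, inner_sum, inner_smul_right, ketBra,
    InnerProductSpace.rankOne_apply, orthonormal_iff_ite.1 orthonormal_ket]
  simp

theorem inner_conjMap {ι κ : Type} (A : BOp ι κ) (T : TraceClass ι) (x y : Hil κ) :
    ⟪x, (conjMap A T : BOp κ κ) y⟫_ℂ = ⟪(A†) x, (T : BOp ι ι) ((A†) y)⟫_ℂ :=
  (ContinuousLinearMap.adjoint_inner_left A _ _).symm

theorem qubitInclusion_ket (a : Fin 2) : qubitInclusion (ket a) = ket (a : ℕ) :=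
  isometryOfOrthonormal_ket _ a

theorem qubitEmbed_ketBra (a b : Fin 2) :
    qubitEmbed (ketBra a b) = ketBra (a : ℕ) (b : ℕ) := by
  refine Subtype.ext (BOp.ext_inner_ket fun i j => ?_)
  rw [qubitEmbed, inner_conjMap]
  simp only [ketBra, InnerProductSpace.rankOne_apply, inner_smul_right,
    ContinuousLinearMap.adjoint_inner_left, ContinuousLinearMap.adjoint_inner_right]
  change ⟪qubitInclusion (ket b), ket j⟫_ℂ * ⟪ket i, qubitInclusion (ket a)⟫_ℂ = _
  rw [qubitInclusion_ket, qubitInclusion_ket]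

theorem inner_qubitRestriction (Φ : TraceClass ℕ →ₗ[ℂ] TraceClass ℕ) (ρ : TraceClass (Fin 2))
    (m n : Fin 2) :
    ⟪ket m, (qubitRestriction Φ ρ : BOp (Fin 2) (Fin 2)) (ket n)⟫_ℂ =
      ⟪ket (m : ℕ), (Φ (qubitEmbed ρ) : BOp ℕ ℕ) (ket (n : ℕ))⟫_ℂ := by
  rw [qubitRestriction, LinearMap.comp_apply, inner_conjMap,
    ContinuousLinearMap.adjoint_adjoint, ← qubitInclusion_ket, ← qubitInclusion_ket]
  rfl

theorem choiMatrix_qubitRestriction (Φ : TraceClass ℕ →ₗ[ℂ] TraceClass ℕ) :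
    choiMatrix (qubitRestriction Φ) = Matrix.of fun x y : Fin 2 × Fin 2 =>
      ⟪ket (x.2 : ℕ), (Φ (ketBra (x.1 : ℕ) (y.1 : ℕ)) : BOp ℕ ℕ) (ket (y.2 : ℕ))⟫_ℂ := by
  ext x y
  rw [choiMatrix, Matrix.of_apply, Matrix.of_apply, inner_qubitRestriction, qubitEmbed_ketBra]

theorem adjoint_qubitInclusion_ket (a : Fin 2) :
    (qubitInclusion.toContinuousLinearMap†) (ket (a : ℕ)) = ket a := by
  ext b
  rw [← inner_ket, ContinuousLinearMap.adjoint_inner_right, ← inner_ket, ← qubitInclusion_ket]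
  exact qubitInclusion.inner_map_map _ _

theorem adjoint_qubitInclusion_ket_of_two_le {m : ℕ} (hm : 2 ≤ m) :
    (qubitInclusion.toContinuousLinearMap†) (ket m) = 0 := by
  ext b
  rw [← inner_ket, ContinuousLinearMap.adjoint_inner_right]
  change ⟪qubitInclusion (ket b), ket m⟫_ℂ = 0
  rw [qubitInclusion_ket, inner_ket, ket_apply, if_neg]
  have := b.2
  omega

theorem inner_fadingChannel_ketBra (μ : Measure unitInterval) [IsFiniteMeasure μ] (i j m n : ℕ) :
    ⟪ket m, (fadingChannel μ (ketBra i j) : BOp ℕ ℕ) (ket n)⟫_ℂ =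
      ∫ l : unitInterval, ⟪ket m, (pureLoss l (ketBra i j) : BOp ℕ ℕ) (ket n)⟫_ℂ ∂μ :=
  inner_fadingOp μ _ _ _

theorem envVec_lossDilation_eq_zero (l : unitInterval) (a : Fin 2) {m : ℕ} (hm : 2 ≤ m) :
    envVec (lossDilation l) a m = 0 := by
  have h0 : m ≠ 0 := by omega
  have h1 : m ≠ 1 := by omega
  fin_cases a
  · exact (envVec_lossDilation_zero l m).trans (if_neg h0)
  · exact (envVec_lossDilation_one l m).trans (by rw [if_neg h0, if_neg h1])

/-- Loss does not increase the photon number. -/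
theorem inner_fadingChannel_ketBra_eq_zero (μ : Measure unitInterval) [IsFiniteMeasure μ]
    (a b : Fin 2) {m n : ℕ} (h : 2 ≤ m ∨ 2 ≤ n) :
    ⟪ket m, (fadingChannel μ (ketBra (a : ℕ) (b : ℕ)) : BOp ℕ ℕ) (ket n)⟫_ℂ = 0 := by
  rw [inner_fadingChannel_ketBra]
  refine integral_eq_zero_of_ae (Filter.Eventually.of_forall fun l => ?_)
  change ⟪ket m, (pureLoss l (ketBra (a : ℕ) (b : ℕ)) : BOp ℕ ℕ) (ket n)⟫_ℂ = 0
  rw [inner_pureLoss_ketBra]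
  rcases h with h | h
  · rw [envVec_lossDilation_eq_zero l a h, inner_zero_right]
  · rw [envVec_lossDilation_eq_zero l b h, inner_zero_left]

theorem fadingChannel_qubitEmbed (μ : Measure unitInterval) [IsFiniteMeasure μ]
    (ρ : TraceClass (Fin 2)) :
    fadingChannel μ (qubitEmbed ρ) = qubitEmbed (qubitRestriction (fadingChannel μ) ρ) := by
  have key : ∀ a b : Fin 2, fadingChannel μ (qubitEmbed (ketBra a b)) =
      qubitEmbed (qubitRestriction (fadingChannel μ) (ketBra a b)) := by
    intro a b
    refine Subtype.ext (BOp.ext_inner_ket fun m n => ?_)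
    nth_rw 2 [qubitEmbed]
    rw [inner_conjMap, qubitEmbed_ketBra]
    rcases Nat.lt_or_ge m 2 with hm | hm
    · rcases Nat.lt_or_ge n 2 with hn | hn
      · lift m to Fin 2 using hm
        lift n to Fin 2 using hn
        rw [adjoint_qubitInclusion_ket, adjoint_qubitInclusion_ket, inner_qubitRestriction,
          qubitEmbed_ketBra]
      · rw [adjoint_qubitInclusion_ket_of_two_le hn, map_zero, inner_zero_right]
        exact inner_fadingChannel_ketBra_eq_zero μ a b (Or.inr hn)
    · rw [adjoint_qubitInclusion_ket_of_two_le hm, inner_zero_left]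
      exact inner_fadingChannel_ketBra_eq_zero μ a b (Or.inl hm)
  rw [eq_sum_smul_ketBra ρ]
  simp only [map_sum, map_smul, key]

theorem choiMatrix_qubitRestriction_pureLoss (l : unitInterval) :
    (choiMatrix (qubitRestriction (pureLoss l))).submatrix
        (finProdFinEquiv (m := 2) (n := 2)).symm (finProdFinEquiv (m := 2) (n := 2)).symm =
      !![1, 0, 0, (Real.sqrt l : ℂ);
         0, 0, 0, 0;
         0, 0, ((1 - l : ℝ) : ℂ), 0;
         (Real.sqrt l : ℂ), 0, 0, ((l : ℝ) : ℂ)] := by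
  have h1 : ((Real.sqrt l : ℝ) : ℂ) * (Real.sqrt l : ℝ) = ((l : ℝ) : ℂ) := by
    rw [← Complex.ofReal_mul, Real.mul_self_sqrt l.2.1]
  have h2 : ((Real.sqrt (1 - l) : ℝ) : ℂ) * (Real.sqrt (1 - l) : ℝ) = ((1 - l : ℝ) : ℂ) := by
    rw [← Complex.ofReal_mul, Real.mul_self_sqrt (sub_nonneg.2 l.2.2)]
  have e0 : (finProdFinEquiv (m := 2) (n := 2)).symm 0 = (0, 0) := rfl
  have e1 : (finProdFinEquiv (m := 2) (n := 2)).symm 1 = (0, 1) := rfl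
  have e2 : (finProdFinEquiv (m := 2) (n := 2)).symm 2 = (1, 0) := rfl
  have e3 : (finProdFinEquiv (m := 2) (n := 2)).symm 3 = (1, 1) := rfl
  rw [choiMatrix_qubitRestriction]
  simp only [inner_pureLoss_ketBra]
  ext x y
  fin_cases x <;> fin_cases y <;>
    simp [-finProdFinEquiv_symm_apply, e0, e1, e2, e3, envVec_lossDilation_zero,
      envVec_lossDilation_one, orthonormal_iff_ite.1 (orthonormal_ket (ι := ℕ)), inner_smul_left,
      inner_smul_right, -Complex.coe_smul, -inner_self_eq_norm_sq_to_K,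
      h1, h2]

theorem integrable_unitInterval {μ : Measure unitInterval} [IsFiniteMeasure μ]
    {f : unitInterval → ℝ} (hf : Continuous f) : Integrable f μ :=
  hf.integrable_of_hasCompactSupport (HasCompactSupport.of_compactSpace _)

theorem choiMatrix_qubitRestriction_fadingChannel (μ : Measure unitInterval)
    [IsProbabilityMeasure μ] :
    (choiMatrix (qubitRestriction (fadingChannel μ))).submatrix
        (finProdFinEquiv (m := 2) (n := 2)).symm (finProdFinEquiv (m := 2) (n := 2)).symm =
      !![1, 0, 0, ((∫ l, Real.sqrt (l : ℝ) ∂μ : ℝ) : ℂ);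
         0, 0, 0, 0;
         0, 0, 1 - ((∫ l, (l : ℝ) ∂μ : ℝ) : ℂ), 0;
         ((∫ l, Real.sqrt (l : ℝ) ∂μ : ℝ) : ℂ), 0, 0, ((∫ l, (l : ℝ) ∂μ : ℝ) : ℂ)] := by
  have hl : Integrable (fun l : unitInterval => (l : ℝ)) μ :=
    integrable_unitInterval continuous_subtype_val
  have hsub : ∫ l : unitInterval, ((1 - l : ℝ) : ℂ) ∂μ = 1 - ((∫ l, (l : ℝ) ∂μ : ℝ) : ℂ) := by
    rw [integral_complex_ofReal, integral_sub (integrable_const _) hl]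
    simp
  have h : ∀ x y, (choiMatrix (qubitRestriction (fadingChannel μ))).submatrix
        (finProdFinEquiv (m := 2) (n := 2)).symm (finProdFinEquiv (m := 2) (n := 2)).symm x y =
      ∫ l : unitInterval, (choiMatrix (qubitRestriction (pureLoss l))).submatrix
        (finProdFinEquiv (m := 2) (n := 2)).symm (finProdFinEquiv (m := 2) (n := 2)).symm x y
        ∂μ := by
    intro x y
    simp only [choiMatrix_qubitRestriction, Matrix.submatrix_apply, Matrix.of_apply,
      inner_fadingChannel_ketBra]
  ext x y
  rw [h]
  simp only [choiMatrix_qubitRestriction_pureLoss]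
  fin_cases x <;> fin_cases y <;> first
    | exact integral_complex_ofReal
    | exact hsub
    | simp

theorem rank_fading_matrix {s t : ℂ} (h : (1 - t) * (t - s ^ 2) ≠ 0) :
    (!![1, 0, 0, s; 0, 0, 0, 0; 0, 0, 1 - t, 0; s, 0, 0, t] :
      Matrix (Fin 4) (Fin 4) ℂ).rank = 3 := by
  -- The invertible minor obtained by deleting the vanishing row and column.
  set N : Matrix (Fin 3) (Fin 3) ℂ := !![1, 0, s; 0, 1 - t, 0; s, 0, t] with hN
  set E : Matrix (Fin 3) (Fin 4) ℂ := !![1, 0, 0, 0; 0, 0, 1, 0; 0, 0, 0, 1] with hE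
  have hNr : N.rank = 3 := by
    have hdet : IsUnit N.det := by
      rw [isUnit_iff_ne_zero]
      convert h using 1
      rw [hN, Matrix.det_fin_three]
      simp
      ring
    simpa using Matrix.rank_of_isUnit N ((Matrix.isUnit_iff_isUnit_det N).2 hdet)
  set M : Matrix (Fin 4) (Fin 4) ℂ := !![1, 0, 0, s; 0, 0, 0, 0; 0, 0, 1 - t, 0; s, 0, 0, t]
    with hM
  have h1 : M = E.transpose * N * E := by
    ext x y
    fin_cases x <;> fin_cases y <;> simp [hM, hN, hE, Matrix.mul_apply, Fin.sum_univ_three]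
  have h2 : N = E * M * E.transpose := by
    ext x y
    fin_cases x <;> fin_cases y <;> simp [hM, hN, hE, Matrix.mul_apply, Fin.sum_univ_four]
  refine le_antisymm ?_ ?_
  · rw [h1]
    exact ((Matrix.rank_mul_le_left _ _).trans (Matrix.rank_mul_le_right _ _)).trans hNr.le
  · refine hNr.ge.trans ?_
    rw [h2]
    exact (Matrix.rank_mul_le_left _ _).trans (Matrix.rank_mul_le_right _ _)

/-! ### Moments of the transmissivity -/

theorem eq_dirac_of_ae_eq {α : Type} [MeasurableSpace α] [MeasurableSingletonClass α]
    {μ : Measure α} [IsProbabilityMeasure μ] {a : α} (h : ∀ᵐ x ∂μ, x = a) :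
    μ = Measure.dirac a := by
  calc μ = μ.map id := Measure.map_id.symm
    _ = μ.map fun _ => a := Measure.map_congr h
    _ = Measure.dirac a := by rw [Measure.map_const, measure_univ, one_smul]

theorem integral_lt_one_of_ne_dirac {μ : Measure unitInterval} [IsProbabilityMeasure μ]
    (hμ : μ ≠ Measure.dirac 1) : ∫ l, (l : ℝ) ∂μ < 1 := by
  have hi : Integrable (fun l : unitInterval => (l : ℝ)) μ :=
    integrable_unitInterval continuous_subtype_val
  have h0 : 0 ≤ᵐ[μ] fun l : unitInterval => 1 - (l : ℝ) :=
    Filter.Eventually.of_forall fun l => sub_nonneg.2 l.2.2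
  have heq : ∫ l : unitInterval, (1 - (l : ℝ)) ∂μ = 1 - ∫ l, (l : ℝ) ∂μ := by
    rw [integral_sub (integrable_const _) hi]
    simp
  refine lt_of_le_of_ne (sub_nonneg.1 (heq ▸ integral_nonneg_of_ae h0)) fun h => hμ ?_
  rw [h, sub_self, integral_eq_zero_iff_of_nonneg_ae h0 ((integrable_const _).sub hi)] at heq
  refine eq_dirac_of_ae_eq (heq.mono fun l hl => Subtype.ext ?_)
  exact (sub_eq_zero.1 hl).symm

/-- The difference is the variance of `√λ`. -/
theorem integral_sub_sq_integral_sqrt_pos {μ : Measure unitInterval} [IsProbabilityMeasure μ]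
    (hμ : ∀ l, μ ≠ Measure.dirac l) : 0 < ∫ l, (l : ℝ) ∂μ - (∫ l, Real.sqrt (l : ℝ) ∂μ) ^ 2 := by
  set c := ∫ l, Real.sqrt (l : ℝ) ∂μ with hc
  have hi : Integrable (fun l : unitInterval => (l : ℝ)) μ :=
    integrable_unitInterval continuous_subtype_val
  have hs : Integrable (fun l : unitInterval => Real.sqrt l) μ :=
    integrable_unitInterval (Real.continuous_sqrt.comp continuous_subtype_val)
  have hv : Integrable (fun l : unitInterval => (Real.sqrt l - c) ^ 2) μ :=
    integrable_unitInterval (by fun_prop)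
  have h0 : 0 ≤ᵐ[μ] fun l : unitInterval => (Real.sqrt l - c) ^ 2 :=
    Filter.Eventually.of_forall fun l => sq_nonneg _
  have heq : ∫ l : unitInterval, (Real.sqrt l - c) ^ 2 ∂μ = ∫ l, (l : ℝ) ∂μ - c ^ 2 := by
    have h : ∀ l : unitInterval, (Real.sqrt l - c) ^ 2 = l - 2 * c * Real.sqrt l + c ^ 2 := by
      intro l
      rw [sub_sq, Real.sq_sqrt l.2.1]
      ring
    simp only [h]
    have hs2 : Integrable (fun l : unitInterval => 2 * c * Real.sqrt l) μ := hs.const_mul _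
    have hd : Integrable (fun l : unitInterval => (l : ℝ) - 2 * c * Real.sqrt l) μ := hi.sub hs2
    rw [integral_add hd (integrable_const _), integral_sub hi hs2, integral_const_mul, ← hc]
    simp
    ring
  rw [← heq]
  refine lt_of_le_of_ne (integral_nonneg_of_ae h0) fun h => ?_
  have hae := (integral_eq_zero_iff_of_nonneg_ae h0 hv).1 h.symm
  have hsq : ∀ᵐ l : unitInterval ∂μ, (l : ℝ) = c ^ 2 := hae.mono fun l hl => by
    rw [← sub_eq_zero.1 (pow_eq_zero_iff two_ne_zero |>.1 hl), Real.sq_sqrt l.2.1]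
  obtain ⟨l₀, hl₀⟩ := hsq.exists
  exact hμ l₀ (eq_dirac_of_ae_eq (hsq.mono fun l hl => Subtype.ext (hl.trans hl₀.symm)))

/-! ### Non-degradability of fading channels -/

theorem fadingChannel_dirac (l : unitInterval) :
    fadingChannel (Measure.dirac l) = pureLoss (l : ℝ) := by
  ext1 ρ
  refine Subtype.ext (ContinuousLinearMap.ext fun x => ?_)
  exact (fadingOp_apply _ ρ x).trans (integral_dirac _ _)

theorem rank_choiMatrix_fadingChannel {μ : Measure unitInterval} [IsProbabilityMeasure μ]
    (hμ : ∀ l, μ ≠ Measure.dirac l) :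
    (choiMatrix (qubitRestriction (fadingChannel μ))).rank = 3 := by
  have h := Matrix.rank_submatrix (choiMatrix (qubitRestriction (fadingChannel μ)))
    (finProdFinEquiv (m := 2) (n := 2)).symm (finProdFinEquiv (m := 2) (n := 2)).symm
  rw [← h, choiMatrix_qubitRestriction_fadingChannel]
  refine rank_fading_matrix (mul_ne_zero ?_ ?_)
  · exact_mod_cast (sub_pos.2 (integral_lt_one_of_ne_dirac (hμ 1))).ne'
  · exact_mod_cast (integral_sub_sq_integral_sqrt_pos hμ).ne'

theorem not_isDegradable_fadingChannel {μ : Measure unitInterval} [IsProbabilityMeasure μ]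
    (hμ : ∀ l, μ ≠ Measure.dirac l) : ¬ IsDegradable (fadingChannel μ) := by
  intro hdeg
  have h := rank_choi_le_two_of_isDegradable hdeg (fun a : Fin 2 => (a : ℕ)) Fin.val_injective
    fun a m hm => inner_fadingChannel_ketBra_eq_zero μ a a (Or.inl (by
      by_contra hlt
      exact hm ⟨⟨m, not_le.1 hlt⟩, rfl⟩))
  rw [← choiMatrix_qubitRestriction, rank_choiMatrix_fadingChannel hμ] at h
  omega

/-- Every degradable qubit channel has Choi rank at most 2. For every distribution `μ` of the
transmissivity, the fading channel `Φ_μ` maps the qubit subspace `span {|0⟩, |1⟩}` to itself, with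
the displayed Choi matrix; if `μ` is not a Dirac measure, this matrix has rank 3 and `Φ_μ` is not
degradable. Hence `Φ_μ` is degradable only if it is a single pure-loss channel. -/
theorem mainTheorem3 :
    (∀ Φ : TraceClass (Fin 2) →ₗ[ℂ] TraceClass (Fin 2),
      IsDegradable Φ → (choiMatrix Φ).rank ≤ 2) ∧
    ∀ (μ : Measure unitInterval) [IsProbabilityMeasure μ],
      (∀ ρ : TraceClass (Fin 2),
        fadingChannel μ (qubitEmbed ρ) = qubitEmbed (qubitRestriction (fadingChannel μ) ρ)) ∧
      (choiMatrix (qubitRestriction (fadingChannel μ))).submatrix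
          (finProdFinEquiv (m := 2) (n := 2)).symm (finProdFinEquiv (m := 2) (n := 2)).symm =
        !![1, 0, 0, ((∫ l, Real.sqrt (l : ℝ) ∂μ : ℝ) : ℂ);
           0, 0, 0, 0;
           0, 0, 1 - ((∫ l, (l : ℝ) ∂μ : ℝ) : ℂ), 0;
           ((∫ l, Real.sqrt (l : ℝ) ∂μ : ℝ) : ℂ), 0, 0, ((∫ l, (l : ℝ) ∂μ : ℝ) : ℂ)] ∧
      ((∀ l : unitInterval, μ ≠ Measure.dirac l) →
        (∫ l, (l : ℝ) ∂μ) < 1 ∧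
        0 < (∫ l, (l : ℝ) ∂μ) - (∫ l, Real.sqrt (l : ℝ) ∂μ) ^ 2 ∧
        (choiMatrix (qubitRestriction (fadingChannel μ))).rank = 3 ∧
        ¬ IsDegradable (fadingChannel μ)) ∧
      (IsDegradable (fadingChannel μ) →
        ∃ l : unitInterval, μ = Measure.dirac l ∧ fadingChannel μ = pureLoss (l : ℝ)) := by
  refine ⟨fun Φ hΦ => rank_choiMatrix_le_two_of_isDegradable hΦ, fun μ _ =>
    ⟨fadingChannel_qubitEmbed μ, choiMatrix_qubitRestriction_fadingChannel μ, fun hμ =>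
      ⟨integral_lt_one_of_ne_dirac (hμ 1), integral_sub_sq_integral_sqrt_pos hμ,
        rank_choiMatrix_fadingChannel hμ, not_isDegradable_fadingChannel hμ⟩, fun hdeg => ?_⟩⟩
  by_cases hμ : ∀ l : unitInterval, μ ≠ Measure.dirac l
  · exact absurd hdeg (not_isDegradable_fadingChannel hμ)
  · push Not at hμ
    obtain ⟨l, rfl⟩ := hμ
    exact ⟨l, rfl, fadingChannel_dirac l⟩
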